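/- Let $\mathbb G$ be a coamenable locally compact quantum group in the sense of Kustermans and Vaes, with $C^*$-algebra $\mathrm C_0(\mathbb G)$ and comultiplication $\Delta:\mathrm C_0(\mathbb G)\to M(\mathrm C_0(\mathbb G)\otimes \mathrm C_0(\mathbb G))$; that is, $\Delta$ is nondegenerate and coassociative, satisfies the quantum cancellation laws, and $\mathrm C_0(\mathbb G)$ carries faithful left and right invariant KMS weights; coamenable means that there is a bounded counit. Equip $\mathrm M(\mathbb G)=\mathrm C_0(\mathbb G)^*$ with the convolution product $\omega\star\mu=(\omega\otimes\mu)\circ\Delta$. For $\omega\in \mathrm M(\mathbb G)$ let $\omega=v\cdot|\omega|_r$, i.e. $\omega(x)=|\omega|_r(xv)$, be its polar decomposition, where $|\omega|_r$ is a positive functional and $v\in \mathrm C_0(\mathbb G)^{**}$ is a partial isometry such that $v^*v$ is the support of $|\omega|_r$; the functional $|\omega|_r$ is the right absolute value of $\omega$, and the left absolute value is $|\omega|_l(x)=|\omega|_r(v^*xv)$. Let $\omega\in\mathrm M(\mathbb G)$ be a contractive idempotent, i.e. $\omega\neq 0$, $\|\omega\|\le 1$ and $\omega\star\omega=\omega$.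 Suppose that $|\omega|_r$ is a Haar idempotent, with associated compact quantum subgroup $(\mathbb H,\pi)$: $\mathbb H$ is a compact quantum group (a locally compact quantum group whose $C^*$-algebra $\mathrm C(\mathbb H)$ is unital), with comultiplication $\Delta_{\mathbb H}$ and Haar state $h_{\mathbb H}$; the map $\pi:\mathrm C_0(\mathbb G)\to \mathrm C(\mathbb H)$ is a surjective $*$-homomorphism with $(\pi\otimes\pi)\Delta=\Delta_{\mathbb H}\pi$; and $|\omega|_r=h_{\mathbb H}\circ\pi$. Then there is a group-like unitary $u\in \mathrm C(\mathbb H)$, i.e. a unitary with $\Delta_{\mathbb H}(u)=u\otimes u$, such that \[ \omega(a)=h_{\mathbb H}(\pi(a)u)\qquad (a\in \mathrm C_0(\mathbb G)). \] Moreover, $|\omega|_r=|\omega|_l$. -/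

import Mathlib

open scoped TensorProduct InnerProductSpace Topology ENNReal ComplexOrder
open Filter

namespace QuantumGroup

noncomputable section

universe u u' v w

set_option linter.unusedSectionVars false

/-- The Hilbert space tensor product: the completion of the algebraic tensor product with respect
to the inner product `⟪ξ ⊗ η, ξ' ⊗ η'⟫ = ⟪ξ, ξ'⟫ * ⟪η, η'⟫`. -/
def HilbertTensor (H : Type v) (K : Type w) [NormedAddCommGroup H] [InnerProductSpace ℂ H]
    [NormedAddCommGroup K] [InnerProductSpace ℂ K] : Type (max v w) :=
  UniformSpace.Completion (H ⊗[ℂ] K)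

section Tensor

variable {A : Type u} [NonUnitalCStarAlgebra A]
variable {H : Type v} [NormedAddCommGroup H] [InnerProductSpace ℂ H] [CompleteSpace H]
variable {K : Type w} [NormedAddCommGroup K] [InnerProductSpace ℂ K] [CompleteSpace K]

instance : NormedAddCommGroup (HilbertTensor H K) :=
  inferInstanceAs (NormedAddCommGroup (UniformSpace.Completion (H ⊗[ℂ] K)))

instance : InnerProductSpace ℂ (HilbertTensor H K) :=
  inferInstanceAs (InnerProductSpace ℂ (UniformSpace.Completion (H ⊗[ℂ] K)))

instance : CompleteSpace (HilbertTensor H K) :=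
  inferInstanceAs (CompleteSpace (UniformSpace.Completion (H ⊗[ℂ] K)))

/-- The inclusion of the algebraic tensor product in the Hilbert space tensor product. -/
def ofAlg : H ⊗[ℂ] K →ₗᵢ[ℂ] HilbertTensor H K := UniformSpace.Completion.toComplₗᵢ

theorem denseRange_ofAlg : DenseRange (ofAlg (H := H) (K := K)) :=
  UniformSpace.Completion.denseRange_coe

/-- The elementary tensor `ξ ⊗ η` in the Hilbert space tensor product. -/
def hTmul (ξ : H) (η : K) : HilbertTensor H K := ofAlg (ξ ⊗ₜ[ℂ] η)

/-- The operator `S ⊗ T` on the Hilbert space tensor product: the continuous extension of the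
operator `S ⊗ T` on the algebraic tensor product. -/
def opTensor (S : H →L[ℂ] H) (T : K →L[ℂ] K) : HilbertTensor H K →L[ℂ] HilbertTensor H K :=
  LinearMap.extendOfNorm
    ((ofAlg : H ⊗[ℂ] K →ₗᵢ[ℂ] HilbertTensor H K).toLinearMap ∘ₗ
      (TensorProduct.mapL S T).toLinearMap)
    (ofAlg : H ⊗[ℂ] K →ₗᵢ[ℂ] HilbertTensor H K).toLinearMap

theorem opTensor_ofAlg (S : H →L[ℂ] H) (T : K →L[ℂ] K) (x : H ⊗[ℂ] K) :
    opTensor S T (ofAlg x) = ofAlg (TensorProduct.mapL S T x) :=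
  LinearMap.extendOfNorm_eq
    (f := (ofAlg : H ⊗[ℂ] K →ₗᵢ[ℂ] HilbertTensor H K).toLinearMap ∘ₗ
      (TensorProduct.mapL S T).toLinearMap)
    (e := (ofAlg : H ⊗[ℂ] K →ₗᵢ[ℂ] HilbertTensor H K).toLinearMap) denseRange_ofAlg
    ⟨‖TensorProduct.mapL S T‖, fun x => by
      refine le_trans (le_of_eq (ofAlg.norm_map _)) (le_trans
        ((TensorProduct.mapL S T).le_opNorm x) (le_of_eq ?_))
      congr 1
      exact (ofAlg.norm_map x).symm⟩ x

theorem op_ext {F : Type*} [NormedAddCommGroup F] [NormedSpace ℂ F]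
    {S T : HilbertTensor H K →L[ℂ] F} (h : ∀ x : H ⊗[ℂ] K, S (ofAlg x) = T (ofAlg x)) : S = T := by
  ext x
  induction x using (denseRange_ofAlg (H := H) (K := K)).induction_on with
  | hp => exact isClosed_eq S.continuous T.continuous
  | ih x => exact h x

/-- `opTensor` as a bilinear map, in order to extend it to sums of elementary tensors. -/
def opTensorBilin : (H →L[ℂ] H) →ₗ[ℂ] (K →L[ℂ] K) →ₗ[ℂ]
    (HilbertTensor H K →L[ℂ] HilbertTensor H K) :=
  LinearMap.mk₂ ℂ opTensor
    (fun S S' T => op_ext fun x => by simp [opTensor_ofAlg, TensorProduct.mapL_add_left, -TensorProduct.mapL_apply])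
    (fun c S T => op_ext fun x => by simp [opTensor_ofAlg, TensorProduct.mapL_smul_left, -TensorProduct.mapL_apply])
    (fun S T T' => op_ext fun x => by simp [opTensor_ofAlg, TensorProduct.mapL_add_right, -TensorProduct.mapL_apply])
    (fun c S T => op_ext fun x => by simp [opTensor_ofAlg, TensorProduct.mapL_smul_right, -TensorProduct.mapL_apply])

/-- For representations `θ₁`, `θ₂` of `A`, the map `∑ aᵢ ⊗ bᵢ ↦ ∑ θ₁ aᵢ ⊗ θ₂ bᵢ` on the
algebraic tensor product. -/
def algTensorHom (θ₁ : A →⋆ₙₐ[ℂ] (H →L[ℂ] H)) (θ₂ : A →⋆ₙₐ[ℂ] (K →L[ℂ] K)) :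
    A ⊗[ℂ] A →ₗ[ℂ] (HilbertTensor H K →L[ℂ] HilbertTensor H K) :=
  TensorProduct.lift (opTensorBilin.compl₁₂ (θ₁ : A →ₗ[ℂ] (H →L[ℂ] H)) (θ₂ : A →ₗ[ℂ] (K →L[ℂ] K)))

theorem algTensorHom_tmul (θ₁ : A →⋆ₙₐ[ℂ] (H →L[ℂ] H)) (θ₂ : A →⋆ₙₐ[ℂ] (K →L[ℂ] K)) (a b : A) :
    algTensorHom θ₁ θ₂ (a ⊗ₜ b) = opTensor (θ₁ a) (θ₂ b) := rfl

/-- The spatial tensor product `A ⊗ A` of a C⋆-algebra `A`, faithfully represented by `ρ` on `H`,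
as the norm closure of the span of the operators `ρ a ⊗ ρ b` on `H ⊗ H`. -/
def spatialTensor (ρ : A →⋆ₙₐ[ℂ] (H →L[ℂ] H)) :
    Submodule ℂ (HilbertTensor H H →L[ℂ] HilbertTensor H H) :=
  (LinearMap.range (algTensorHom ρ ρ)).topologicalClosure

/-- The algebraic tensor product, mapped into the spatial tensor product. -/
def algToSpatial (ρ : A →⋆ₙₐ[ℂ] (H →L[ℂ] H)) : A ⊗[ℂ] A →ₗ[ℂ] spatialTensor ρ :=
  (algTensorHom ρ ρ).codRestrict _ fun x =>
    Submodule.le_topologicalClosure _ (LinearMap.mem_range_self _ x)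

theorem denseRange_algToSpatial (ρ : A →⋆ₙₐ[ℂ] (H →L[ℂ] H)) : DenseRange (algToSpatial ρ) := by
  intro x
  rw [closure_subtype]
  have h := x.2
  unfold spatialTensor at h
  rw [← SetLike.mem_coe, Submodule.topologicalClosure_coe] at h
  refine closure_mono ?_ h
  rintro _ ⟨y, rfl⟩
  exact ⟨_, ⟨y, rfl⟩, rfl⟩

/-- The functional `∑ aᵢ ⊗ bᵢ ↦ ∑ ω aᵢ * μ bᵢ` on the algebraic tensor product. -/
def algTensorFunctional (ω μ : StrongDual ℂ A) : A ⊗[ℂ] A →ₗ[ℂ] ℂ :=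
  TensorProduct.lift ((LinearMap.mul ℂ ℂ).compl₁₂ (ω : A →ₗ[ℂ] ℂ) (μ : A →ₗ[ℂ] ℂ))

theorem algTensorFunctional_tmul (ω μ : StrongDual ℂ A) (a b : A) :
    algTensorFunctional ω μ (a ⊗ₜ b) = ω a * μ b := rfl

theorem inner_hTmul (ξ ξ' : H) (η η' : K) :
    ⟪hTmul ξ η, hTmul ξ' η'⟫_ℂ = ⟪ξ, ξ'⟫_ℂ * ⟪η, η'⟫_ℂ := by
  simp [hTmul]

theorem opTensor_hTmul (S : H →L[ℂ] H) (T : K →L[ℂ] K) (ξ : H) (η : K) :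
    opTensor S T (hTmul ξ η) = hTmul (S ξ) (T η) := by
  simp [hTmul, opTensor_ofAlg]

/-- The coefficient functional `a ↦ ⟪ξ, θ a η⟫`. -/
def coeff (θ : A →⋆ₙₐ[ℂ] (H →L[ℂ] H)) (ξ η : H) : StrongDual ℂ A :=
  LinearMap.mkContinuous
    { toFun := fun a => ⟪ξ, θ a η⟫_ℂ
      map_add' := by simp
      map_smul' := by simp } (‖ξ‖ * ‖η‖) fun a => by
    simp only [LinearMap.coe_mk, AddHom.coe_mk]
    calc ‖⟪ξ, θ a η⟫_ℂ‖ ≤ ‖ξ‖ * ‖θ a η‖ := norm_inner_le_norm _ _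
      _ ≤ ‖ξ‖ * (‖θ a‖ * ‖η‖) := by gcongr; exact (θ a).le_opNorm η
      _ ≤ ‖ξ‖ * (‖a‖ * ‖η‖) := by gcongr; exact NonUnitalStarAlgHom.norm_apply_le θ a
      _ = _ := by ring

theorem inner_algTensorHom (θ₁ : A →⋆ₙₐ[ℂ] (H →L[ℂ] H)) (θ₂ : A →⋆ₙₐ[ℂ] (K →L[ℂ] K))
    (ξ ξ' : H) (η η' : K) (x : A ⊗[ℂ] A) :
    ⟪hTmul ξ η, algTensorHom θ₁ θ₂ x (hTmul ξ' η')⟫_ℂ =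
      algTensorFunctional (coeff θ₁ ξ ξ') (coeff θ₂ η η') x := by
  induction x with
  | zero => simp
  | tmul a b => simp [algTensorHom_tmul, opTensor_hTmul, inner_hTmul, algTensorFunctional_tmul, coeff]
  | add x y hx hy => simp [hx, hy]

theorem norm_le_of_coeff (ρ : A →⋆ₙₐ[ℂ] (H →L[ℂ] H)) (hρ : Function.Injective ρ) (a : A) {C : ℝ}
    (hC : 0 ≤ C) (h : ∀ ξ η, ‖coeff ρ ξ η a‖ ≤ C * ‖ξ‖ * ‖η‖) : ‖a‖ ≤ C := by
  rw [← NonUnitalStarAlgHom.norm_map ρ hρ a]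
  refine ContinuousLinearMap.opNorm_le_bound _ hC fun η => ?_
  have := h (ρ a η) η
  have h2 : coeff ρ (ρ a η) η a = (‖ρ a η‖ : ℂ) ^ 2 := by
    simp [coeff, inner_self_eq_norm_sq_to_K]
  rw [h2, norm_pow, Complex.norm_real, norm_norm] at this
  rcases (norm_nonneg (ρ a η)).eq_or_lt with h0 | h0
  · rw [← h0]; positivity
  · nlinarith

/-- A product functional is bounded for the spatial norm. -/
theorem norm_algTensorFunctional_le (ρ : A →⋆ₙₐ[ℂ] (H →L[ℂ] H)) (hρ : Function.Injective ρ)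
    (ω μ : StrongDual ℂ A) (x : A ⊗[ℂ] A) :
    ‖algTensorFunctional ω μ x‖ ≤ ‖ω‖ * ‖μ‖ * ‖algTensorHom ρ ρ x‖ := by
  let Rs (g : StrongDual ℂ A) : A ⊗[ℂ] A →ₗ[ℂ] A :=
    TensorProduct.lift ((LinearMap.lsmul ℂ A).flip.compl₂ (g : A →ₗ[ℂ] ℂ))
  let Ls (f : StrongDual ℂ A) : A ⊗[ℂ] A →ₗ[ℂ] A :=
    TensorProduct.lift ((LinearMap.lsmul ℂ A).comp (f : A →ₗ[ℂ] ℂ))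
  have hR : ∀ f g : StrongDual ℂ A, algTensorFunctional f g x = f (Rs g x) := by
    intro f g
    have : algTensorFunctional f g = (f : A →ₗ[ℂ] ℂ) ∘ₗ Rs g := by
      ext a b; simp [algTensorFunctional, Rs, mul_comm]
    rw [this]; rfl
  have hL : ∀ f g : StrongDual ℂ A, algTensorFunctional f g x = g (Ls f x) := by
    intro f g
    have : algTensorFunctional f g = (g : A →ₗ[ℂ] ℂ) ∘ₗ Ls f := by
      ext a b; simp [algTensorFunctional, Ls]
    rw [this]; rfl
  have h1 : ∀ ξ ξ' : H, ‖Ls (coeff ρ ξ ξ') x‖ ≤ ‖algTensorHom ρ ρ x‖ * ‖ξ‖ * ‖ξ'‖ := by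
    intro ξ ξ'
    refine norm_le_of_coeff ρ hρ _ (by positivity) fun η η' => ?_
    rw [← hL, ← inner_algTensorHom]
    have e : ∀ a b : H, ‖hTmul a b‖ = ‖a‖ * ‖b‖ := fun a b => by simp [hTmul]
    calc _ ≤ ‖hTmul ξ η‖ * ‖algTensorHom ρ ρ x (hTmul ξ' η')‖ := norm_inner_le_norm _ _
      _ ≤ ‖hTmul ξ η‖ * (‖algTensorHom ρ ρ x‖ * ‖hTmul ξ' η'‖) := by
          gcongr; exact ContinuousLinearMap.le_opNorm _ _
      _ = _ := by rw [e, e]; ring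
  have h2 : ‖Rs μ x‖ ≤ ‖μ‖ * ‖algTensorHom ρ ρ x‖ := by
    refine norm_le_of_coeff ρ hρ _ (by positivity) fun ξ ξ' => ?_
    rw [← hR, hL]
    calc _ ≤ ‖μ‖ * ‖Ls (coeff ρ ξ ξ') x‖ := μ.le_opNorm _
      _ ≤ ‖μ‖ * (‖algTensorHom ρ ρ x‖ * ‖ξ‖ * ‖ξ'‖) := by gcongr; exact h1 ξ ξ'
      _ = _ := by ring
  rw [hR]
  calc _ ≤ ‖ω‖ * ‖Rs μ x‖ := ω.le_opNorm _
    _ ≤ ‖ω‖ * (‖μ‖ * ‖algTensorHom ρ ρ x‖) := by gcongr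
    _ = _ := by ring

theorem opTensor_mul (S S' : H →L[ℂ] H) (T T' : K →L[ℂ] K) :
    opTensor (S * S') (T * T') = opTensor S T * opTensor S' T' :=
  op_ext fun x => by
    rw [mul_apply_eq_comp, opTensor_ofAlg, opTensor_ofAlg, opTensor_ofAlg,
      TensorProduct.mapL_mul]; rfl

theorem opTensor_star_inner (S : H →L[ℂ] H) (T : K →L[ℂ] K) (x y : HilbertTensor H K) :
    ⟪opTensor (star S) (star T) x, y⟫_ℂ = ⟪x, opTensor S T y⟫_ℂ := by
  induction x, y using (denseRange_ofAlg (H := H) (K := K)).induction_on₂ with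
  | hp => exact isClosed_eq (by fun_prop) (by fun_prop)
  | h x y =>
    rw [opTensor_ofAlg, opTensor_ofAlg, LinearIsometry.inner_map_map,
      LinearIsometry.inner_map_map]
    induction x with
    | zero => simp
    | add x₁ x₂ h₁ h₂ => simp only [map_add, inner_add_left, h₁, h₂]
    | tmul a b =>
      induction y with
      | zero => simp
      | add x₁ x₂ h₁ h₂ => simp only [map_add, inner_add_right, h₁, h₂]
      | tmul c d => simp [ContinuousLinearMap.star_eq_adjoint, ContinuousLinearMap.adjoint_inner_left]


theorem algTensorHom_mul (θ₁ : A →⋆ₙₐ[ℂ] (H →L[ℂ] H)) (θ₂ : A →⋆ₙₐ[ℂ] (K →L[ℂ] K))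
    (x y : A ⊗[ℂ] A) :
    algTensorHom θ₁ θ₂ (x * y) = algTensorHom θ₁ θ₂ x * algTensorHom θ₁ θ₂ y := by
  induction x with
  | zero => simp
  | add x₁ x₂ h₁ h₂ => simp only [add_mul, map_add, h₁, h₂]
  | tmul a b =>
    induction y with
    | zero => simp
    | add x₁ x₂ h₁ h₂ => simp only [mul_add, map_add, h₁, h₂]
    | tmul c d =>
      simp only [Algebra.TensorProduct.tmul_mul_tmul, algTensorHom_tmul, map_mul, opTensor_mul]

theorem algTensorHom_star (θ₁ : A →⋆ₙₐ[ℂ] (H →L[ℂ] H)) (θ₂ : A →⋆ₙₐ[ℂ] (K →L[ℂ] K))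
    (x : A ⊗[ℂ] A) : algTensorHom θ₁ θ₂ (star x) = star (algTensorHom θ₁ θ₂ x) := by
  induction x with
  | zero => simp
  | add x₁ x₂ h₁ h₂ => simp only [star_add, map_add, h₁, h₂]
  | tmul a b =>
    rw [TensorProduct.star_tmul, algTensorHom_tmul, algTensorHom_tmul, map_star, map_star,
      ContinuousLinearMap.star_eq_adjoint (opTensor _ _), ContinuousLinearMap.eq_adjoint_iff]
    exact opTensor_star_inner _ _

theorem exists_coeff_bound (ρ : A →⋆ₙₐ[ℂ] (H →L[ℂ] H)) (hρ : Function.Injective ρ)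
    {L₁ : Type*} [NormedAddCommGroup L₁] [InnerProductSpace ℂ L₁] [CompleteSpace L₁]
    {L₂ : Type*} [NormedAddCommGroup L₂] [InnerProductSpace ℂ L₂] [CompleteSpace L₂]
    (θ₁ : A →⋆ₙₐ[ℂ] (L₁ →L[ℂ] L₁)) (θ₂ : A →⋆ₙₐ[ℂ] (L₂ →L[ℂ] L₂)) (ζ ζ' : L₁ ⊗[ℂ] L₂) :
    ∃ C : ℝ, ∀ x : A ⊗[ℂ] A,
      ‖⟪ofAlg ζ, algTensorHom θ₁ θ₂ x (ofAlg ζ')⟫_ℂ‖ ≤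
        C * ‖algTensorHom ρ ρ x‖ := by
  induction ζ with
  | zero => exact ⟨0, fun x => by simp⟩
  | add ζ₁ ζ₂ h₁ h₂ =>
    obtain ⟨C₁, h₁⟩ := h₁
    obtain ⟨C₂, h₂⟩ := h₂
    refine ⟨C₁ + C₂, fun x => ?_⟩
    rw [LinearIsometry.map_add, inner_add_left, add_mul]
    exact (norm_add_le _ _).trans (add_le_add (h₁ x) (h₂ x))
  | tmul a b =>
    induction ζ' with
    | zero => exact ⟨0, fun x => by simp⟩
    | add ζ₁ ζ₂ h₁ h₂ =>
      obtain ⟨C₁, h₁⟩ := h₁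
      obtain ⟨C₂, h₂⟩ := h₂
      refine ⟨C₁ + C₂, fun x => ?_⟩
      rw [LinearIsometry.map_add, map_add, inner_add_right, add_mul]
      exact (norm_add_le _ _).trans (add_le_add (h₁ x) (h₂ x))
    | tmul c d =>
      refine ⟨‖coeff θ₁ a c‖ * ‖coeff θ₂ b d‖, fun x => ?_⟩
      have := inner_algTensorHom θ₁ θ₂ a c b d x
      unfold hTmul at this
      rw [this]
      exact norm_algTensorFunctional_le ρ hρ _ _ x

theorem le_of_pow_growth {z b r C : ℝ} (hz : 0 ≤ z) (hr : 0 ≤ r)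
    (h0 : z = 0 → b = 0) (h : ∀ n : ℕ, z * b ^ 2 ^ n ≤ C * (z * r) ^ 2 ^ n) : b ≤ z * r := by
  by_contra! hlt
  have hz' : 0 < z := hz.lt_of_ne fun e => by
    rw [h0 e.symm, ← e] at hlt; simp at hlt
  rcases (mul_nonneg hz hr).eq_or_lt with e | e
  · have := h 0
    rw [← e] at this hlt
    simp at this
    nlinarith [mul_pos hz' hlt]
  · have h1 : 1 < b / (z * r) := (one_lt_div e).2 hlt
    have ht := (tendsto_pow_atTop_atTop_of_one_lt h1).comp
      (tendsto_pow_atTop_atTop_of_one_lt (α := ℕ) one_lt_two)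
    obtain ⟨n, hn⟩ := (ht.eventually_gt_atTop (C / z)).exists
    have := h n
    simp only [Function.comp, div_pow] at hn
    rw [div_lt_div_iff₀ hz' (by positivity)] at hn
    nlinarith

/-- The tensor product of two representations is bounded for the spatial norm. -/
theorem norm_algTensorHom_le (ρ : A →⋆ₙₐ[ℂ] (H →L[ℂ] H)) (hρ : Function.Injective ρ)
    {L₁ : Type*} [NormedAddCommGroup L₁] [InnerProductSpace ℂ L₁] [CompleteSpace L₁]
    {L₂ : Type*} [NormedAddCommGroup L₂] [InnerProductSpace ℂ L₂] [CompleteSpace L₂]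
    (θ₁ : A →⋆ₙₐ[ℂ] (L₁ →L[ℂ] L₁)) (θ₂ : A →⋆ₙₐ[ℂ] (L₂ →L[ℂ] L₂)) (x : A ⊗[ℂ] A) :
    ‖algTensorHom θ₁ θ₂ x‖ ≤ ‖algTensorHom ρ ρ x‖ := by
  have key : ∀ ζ : L₁ ⊗[ℂ] L₂, ‖algTensorHom θ₁ θ₂ x (ofAlg ζ)‖ ≤
      ‖algTensorHom ρ ρ x‖ * ‖ofAlg ζ‖ := by
    intro ζ
    obtain ⟨C, hC⟩ := exists_coeff_bound ρ hρ θ₁ θ₂ ζ ζ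
    set ζ' : HilbertTensor L₁ L₂ := ofAlg ζ
    set T := algTensorHom θ₁ θ₂
    set R := algTensorHom ρ ρ
    have hsq : ∀ y : A ⊗[ℂ] A, ((‖T y ζ'‖ : ℂ)) ^ 2 = ⟪ζ', T (star y * y) ζ'⟫_ℂ := by
      intro y
      rw [algTensorHom_mul, algTensorHom_star, mul_apply_eq_comp,
        ContinuousLinearMap.star_eq_adjoint, ContinuousLinearMap.adjoint_inner_right,
        inner_self_eq_norm_sq_to_K]
      rfl
    have hRsq : ∀ y : A ⊗[ℂ] A, ‖R (star y * y)‖ = ‖R y‖ ^ 2 := by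
      intro y
      rw [algTensorHom_mul, algTensorHom_star, CStarRing.norm_star_mul_self, sq]
    let y : ℕ → A ⊗[ℂ] A := fun n => Nat.rec (star x * x) (fun _ z => star z * z) n
    let b : ℕ → ℝ := fun n => Nat.casesOn n (‖T x ζ'‖ ^ 2) (fun k => ‖T (y k) ζ'‖ ^ 2)
    have hb : ∀ n : ℕ, (Complex.ofReal (b n)) = (⟪ζ', T (y n) ζ'⟫_ℂ : ℂ) := by
      intro n
      cases n with
      | zero => rw [show y 0 = star x * x from rfl, ← hsq]; simp [b]
      | succ k =>
        have : y (k + 1) = star (y k) * y k := rfl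
        rw [this, ← hsq]; simp [b]
    have hb0 : ∀ n, 0 ≤ b n := by
      intro n
      cases n with
      | zero => exact sq_nonneg _
      | succ k => exact sq_nonneg _
    have hbn : ∀ n, b n = ‖⟪ζ', T (y n) ζ'⟫_ℂ‖ := fun n => by
      rw [← hb, Complex.norm_real, Real.norm_of_nonneg (hb0 n)]
    have hy : ∀ n, ‖R (y n)‖ = (‖R x‖ ^ 2) ^ 2 ^ n := by
      intro n
      induction n with
      | zero => rw [show y 0 = star x * x from rfl, hRsq]; simp
      | succ k ih =>
        rw [show y (k + 1) = star (y k) * y k from rfl, hRsq, ih, ← pow_mul (‖R x‖ ^ 2), ← pow_succ]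
    have hstep : ∀ n, b n ^ 2 ≤ ‖ζ'‖ ^ 2 * b (n + 1) := by
      intro n
      have : b n ≤ ‖ζ'‖ * ‖T (y n) ζ'‖ := by
        rw [hbn]; exact norm_inner_le_norm _ _
      calc b n ^ 2 ≤ (‖ζ'‖ * ‖T (y n) ζ'‖) ^ 2 := by exact pow_le_pow_left₀ (hb0 n) this 2
        _ = _ := by rw [mul_pow]
    have hpow : ∀ n, ‖ζ'‖ ^ 2 * b 0 ^ 2 ^ n ≤ (‖ζ'‖ ^ 2) ^ 2 ^ n * b n := by
      intro n
      induction n with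
      | zero => simp
      | succ k ih =>
        rcases (sq_nonneg ‖ζ'‖).eq_or_lt with e | e
        · rw [← e]; simp
        · have h1 : (‖ζ'‖ ^ 2 * b 0 ^ 2 ^ k) ^ 2 ≤ ((‖ζ'‖ ^ 2) ^ 2 ^ k * b k) ^ 2 := by
            have := pow_nonneg (hb0 0) (2 ^ k)
            exact pow_le_pow_left₀ (by positivity) ih 2
          have h2 : ((‖ζ'‖ ^ 2) ^ 2 ^ k * b k) ^ 2 ≤
              ‖ζ'‖ ^ 2 * ((‖ζ'‖ ^ 2) ^ 2 ^ (k + 1) * b (k + 1)) := by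
            rw [mul_pow, ← pow_mul (‖ζ'‖ ^ 2), ← pow_succ]
            calc _ ≤ (‖ζ'‖ ^ 2) ^ 2 ^ (k + 1) * (‖ζ'‖ ^ 2 * b (k + 1)) := by
                  gcongr; exact hstep k
              _ = _ := by ring
          have h3 := h1.trans h2
          rw [mul_pow, ← pow_mul (b 0), ← pow_succ, sq (‖ζ'‖ ^ 2), mul_assoc] at h3
          exact le_of_mul_le_mul_left h3 e
    have hfin : b 0 ≤ ‖ζ'‖ ^ 2 * ‖R x‖ ^ 2 := by
      refine le_of_pow_growth (C := C) (sq_nonneg _) (sq_nonneg _) ?_ fun n => ?_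
      · intro e
        have : ζ' = 0 := by simpa using e
        simp [b, this]
      · refine (hpow n).trans ?_
        have := hC (y n)
        rw [← hbn, hy] at this
        calc _ ≤ (‖ζ'‖ ^ 2) ^ 2 ^ n * (C * (‖R x‖ ^ 2) ^ 2 ^ n) := by gcongr
          _ = _ := by rw [mul_pow]; ring
    have : ‖T x ζ'‖ ^ 2 ≤ (‖R x‖ * ‖ζ'‖) ^ 2 := by
      calc _ ≤ _ := hfin
        _ = _ := by ring
    exact le_of_sq_le_sq this (by positivity)
  refine ContinuousLinearMap.opNorm_le_bound _ (norm_nonneg _) fun ζ => ?_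
  induction ζ using (denseRange_ofAlg (H := L₁) (K := L₂)).induction_on with
  | hp => exact isClosed_le (by fun_prop) (by fun_prop)
  | ih ζ => exact key ζ

/-- For representations `θ₁`, `θ₂` of `A`, the representation `θ₁ ⊗ θ₂` of the spatial tensor
product `A ⊗ A`: the continuous map with `ρ a ⊗ ρ b ↦ θ₁ a ⊗ θ₂ b`. -/
def tensorHom (ρ : A →⋆ₙₐ[ℂ] (H →L[ℂ] H))
    {L₁ : Type*} [NormedAddCommGroup L₁] [InnerProductSpace ℂ L₁] [CompleteSpace L₁]
    {L₂ : Type*} [NormedAddCommGroup L₂] [InnerProductSpace ℂ L₂] [CompleteSpace L₂]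
    (θ₁ : A →⋆ₙₐ[ℂ] (L₁ →L[ℂ] L₁)) (θ₂ : A →⋆ₙₐ[ℂ] (L₂ →L[ℂ] L₂)) :
    spatialTensor ρ →L[ℂ] (HilbertTensor L₁ L₂ →L[ℂ] HilbertTensor L₁ L₂) :=
  (algTensorHom θ₁ θ₂).extendOfNorm (algToSpatial ρ)

theorem tensorHom_algToSpatial (ρ : A →⋆ₙₐ[ℂ] (H →L[ℂ] H)) (hρ : Function.Injective ρ)
    {L₁ : Type*} [NormedAddCommGroup L₁] [InnerProductSpace ℂ L₁] [CompleteSpace L₁]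
    {L₂ : Type*} [NormedAddCommGroup L₂] [InnerProductSpace ℂ L₂] [CompleteSpace L₂]
    (θ₁ : A →⋆ₙₐ[ℂ] (L₁ →L[ℂ] L₁)) (θ₂ : A →⋆ₙₐ[ℂ] (L₂ →L[ℂ] L₂)) (x : A ⊗[ℂ] A) :
    tensorHom ρ θ₁ θ₂ (algToSpatial ρ x) = algTensorHom θ₁ θ₂ x :=
  LinearMap.extendOfNorm_eq (denseRange_algToSpatial ρ)
    ⟨1, fun x => by rw [one_mul]; exact norm_algTensorHom_le ρ hρ θ₁ θ₂ x⟩ x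

/-- For bounded functionals `ω`, `μ` on `A`, the functional `ω ⊗ μ` on the spatial tensor product
`A ⊗ A`: the bounded functional with `ρ a ⊗ ρ b ↦ ω a * μ b`. -/
def tensorFunctional (ρ : A →⋆ₙₐ[ℂ] (H →L[ℂ] H)) (ω μ : StrongDual ℂ A) :
    StrongDual ℂ (spatialTensor ρ) :=
  (algTensorFunctional ω μ).extendOfNorm (algToSpatial ρ)

theorem tensorFunctional_algToSpatial (ρ : A →⋆ₙₐ[ℂ] (H →L[ℂ] H)) (hρ : Function.Injective ρ)
    (ω μ : StrongDual ℂ A) (x : A ⊗[ℂ] A) :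
    tensorFunctional ρ ω μ (algToSpatial ρ x) = algTensorFunctional ω μ x :=
  LinearMap.extendOfNorm_eq (denseRange_algToSpatial ρ)
    ⟨_, fun x => norm_algTensorFunctional_le ρ hρ ω μ x⟩ x

end Tensor

section Multipliers

variable {L : Type v} [NormedAddCommGroup L] [InnerProductSpace ℂ L] [CompleteSpace L]

/-- The multiplier algebra `M(D)` of a C⋆-algebra `D` acting nondegenerately on `L`, realised as
the idealizer `{T | T D ⊆ D, D T ⊆ D}` of `D` in the bounded operators on `L`. -/
def multiplierAlgebra (D : Submodule ℂ (L →L[ℂ] L)) : Subalgebra ℂ (L →L[ℂ] L) where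
  carrier := {T | ∀ d ∈ D, T * d ∈ D ∧ d * T ∈ D}
  mul_mem' {S T} hS hT d hd := by
    refine ⟨?_, ?_⟩
    · rw [mul_assoc]; exact (hS _ (hT d hd).1).1
    · rw [← mul_assoc]; exact (hT _ (hS d hd).2).2
  add_mem' {S T} hS hT d hd := by
    refine ⟨?_, ?_⟩
    · rw [add_mul]; exact D.add_mem (hS d hd).1 (hT d hd).1
    · rw [mul_add]; exact D.add_mem (hS d hd).2 (hT d hd).2
  algebraMap_mem' r d hd := by
    refine ⟨?_, ?_⟩
    · rw [← Algebra.smul_def]; exact D.smul_mem r hd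
    · rw [← Algebra.commutes, ← Algebra.smul_def]; exact D.smul_mem r hd

variable {D : Submodule ℂ (L →L[ℂ] L)}

/-- The product `T d ∈ D` of a multiplier `T ∈ M(D)` and `d ∈ D`. -/
def multiplierMul (T : multiplierAlgebra D) (d : D) : D :=
  ⟨(T : L →L[ℂ] L) * (d : L →L[ℂ] L), (T.2 d d.2).1⟩

/-- The filter on `D` of convergence to `1` in the strict topology of `M(D)`, within the closed
unit ball of `D`. -/
def strictUnitFilter (D : Submodule ℂ (L →L[ℂ] L)) : Filter D :=
  𝓟 {e : D | ‖e‖ ≤ 1} ⊓ ⨅ d : D, comap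
    (fun e : D => ((e : L →L[ℂ] L) * (d : L →L[ℂ] L) - d, (d : L →L[ℂ] L) * (e : L →L[ℂ] L) - d))
    (𝓝 0)

/-- The strict extension of a bounded functional `F` on `D` to the multiplier algebra `M(D)`:
`F T = lim F (T e)` as `e → 1` strictly in the unit ball of `D`. The limit exists for every C⋆-algebra
`D`, bounded `F` and multiplier `T`. -/
def strictExt (F : StrongDual ℂ D) (T : multiplierAlgebra D) : ℂ :=
  limUnder (strictUnitFilter D) fun e => F (multiplierMul T e)

/-- `S` is the value at the multiplier `T ∈ M(D)` of the strict extension of a nondegenerate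
representation `Θ` of `D`, i.e. the unique operator with `S Θ(d) = Θ(T d)` for all `d ∈ D`. -/
def IsStrictImage {L' : Type*} [NormedAddCommGroup L'] [InnerProductSpace ℂ L']
    (Θ : D →L[ℂ] (L' →L[ℂ] L')) (T : multiplierAlgebra D) (S : L' →L[ℂ] L') : Prop :=
  ∀ d : D, S * Θ d = Θ (multiplierMul T d)

end Multipliers

section Bidual

variable {A : Type u} [NonUnitalCStarAlgebra A]

/-- A positive functional. -/
def IsPositiveFunctional (ω : StrongDual ℂ A) : Prop := ∀ a, 0 ≤ ω (star a * a)

/-- The functional `ω.a : b ↦ ω (a * b)`. -/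
def functionalMul (ω : StrongDual ℂ A) (a : A) : StrongDual ℂ A :=
  ω ∘L ContinuousLinearMap.mul ℂ A a

/-- The functional `a.ω : b ↦ ω (b * a)`. -/
def mulFunctional (a : A) (ω : StrongDual ℂ A) : StrongDual ℂ A :=
  ω ∘L (ContinuousLinearMap.mul ℂ A).flip a

/-- The bidual `A**`; with the Arens product and the involution below it is the enveloping
von Neumann algebra of `A`. -/
abbrev Bidual (A : Type u) [NonUnitalCStarAlgebra A] : Type u := StrongDual ℂ (StrongDual ℂ A)

/-- The left action `x.ω : a ↦ x (ω.a)` of `x ∈ A**` on `ω ∈ A*`, linear and continuous in `ω`. For `x` in `A`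
this is `a ↦ ω (a * x)`. -/
def bidualAct (x : Bidual A) : StrongDual ℂ A →L[ℂ] StrongDual ℂ A :=
  (ContinuousLinearMap.compL ℂ A (StrongDual ℂ A) ℂ x) ∘L
    ((ContinuousLinearMap.compL ℂ A (A →L[ℂ] A) (StrongDual ℂ A)).flip
      (ContinuousLinearMap.mul ℂ A)) ∘L
    (ContinuousLinearMap.compL ℂ A A ℂ)

theorem bidualAct_apply (x : Bidual A) (ω : StrongDual ℂ A) (a : A) :
    bidualAct x ω a = x (functionalMul ω a) := rfl

/-- The right action `ω.x : a ↦ x (a.ω)` of `x ∈ A**` on `ω ∈ A*`. For `x` in `A` this is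
`a ↦ ω (x * a)`. -/
def actBidual (ω : StrongDual ℂ A) (x : Bidual A) : StrongDual ℂ A :=
  x ∘L (ContinuousLinearMap.compL ℂ A A ℂ ω) ∘L (ContinuousLinearMap.mul ℂ A).flip

theorem actBidual_apply (ω : StrongDual ℂ A) (x : Bidual A) (a : A) :
    actBidual ω x a = x (mulFunctional a ω) := rfl

/-- The Arens product on `A**`: `(x y)(ω) = x (y.ω)`. -/
def bidualMul (x y : Bidual A) : Bidual A := x ∘L bidualAct y

/-- The functional `a ↦ conj (ω (a*))`. -/
def functionalConj (ω : StrongDual ℂ A) : StrongDual ℂ A :=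
  LinearMap.mkContinuous
    { toFun := fun a => star (ω (star a))
      map_add' := by simp
      map_smul' := by simp } ‖ω‖ fun a => by
    simpa using ω.le_opNorm (star a)

/-- The involution on `A**`: `x*(ω) = conj (x (conj ∘ ω ∘ *))`. -/
def bidualStar (x : Bidual A) : Bidual A :=
  LinearMap.mkContinuous
    { toFun := fun ω => star (x (functionalConj ω))
      map_add' := fun ω μ => by
        rw [← star_add, ← map_add]; congr 2; ext a; simp [functionalConj]
      map_smul' := fun c ω => by
        have : functionalConj (c • ω) = star c • functionalConj ω := by
          ext a; simp [functionalConj]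
        simp [this] } ‖x‖ fun ω => by
    have : ‖functionalConj ω‖ ≤ ‖ω‖ := LinearMap.mkContinuous_norm_le _ (norm_nonneg _) _
    simp only [LinearMap.coe_mk, AddHom.coe_mk, norm_star]
    exact (x.le_opNorm _).trans (by gcongr)

/-- `p` is a projection in `A**`. -/
def IsBidualProjection (p : Bidual A) : Prop := bidualStar p = p ∧ bidualMul p p = p

/-- `p` is the support of `φ`: the smallest projection in `A**` with
`φ (p x) = φ (x p) = φ x` for all `x`. -/
def IsSupport (p : Bidual A) (φ : StrongDual ℂ A) : Prop :=
  IsBidualProjection p ∧ (∀ x, bidualMul p x φ = x φ ∧ bidualMul x p φ = x φ) ∧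
    ∀ q, IsBidualProjection q → (∀ x, bidualMul q x φ = x φ ∧ bidualMul x q φ = x φ) →
      bidualMul p q = p

/-- The pair `(u, φ)` is the polar decomposition of `ω`: `φ` is a positive functional, `u` is a
partial isometry in `A**`, `ω = u.φ`, and `u* u` is the support of `φ`. -/
structure IsPolarDecomposition (ω : StrongDual ℂ A) (u : Bidual A) (φ : StrongDual ℂ A) : Prop where
  positive : IsPositiveFunctional φ
  partialIsometry : bidualMul u (bidualMul (bidualStar u) u) = u
  eq_act : ω = bidualAct u φ
  support : IsSupport (bidualMul (bidualStar u) u) φ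

open Classical in
/-- The polar decomposition `(u, φ)` of `ω`. It exists and is unique for every `ω`. -/
def polar (ω : StrongDual ℂ A) : Bidual A × StrongDual ℂ A :=
  if h : ∃ p : Bidual A × StrongDual ℂ A, IsPolarDecomposition ω p.1 p.2 then h.choose else 0

/-- The right absolute value `|ω|_r`. -/
def rightAbs (ω : StrongDual ℂ A) : StrongDual ℂ A := (polar ω).2

/-- The left absolute value `|ω|_l = u.|ω|_r.u*`. -/
def leftAbs (ω : StrongDual ℂ A) : StrongDual ℂ A :=
  actBidual (bidualAct (polar ω).1 (rightAbs ω)) (bidualStar (polar ω).1)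

end Bidual

section Weights

variable {A : Type u} [NonUnitalCStarAlgebra A] [PartialOrder A] [StarOrderedRing A]

/-- A norm-continuous one-parameter group of `*`-automorphisms of `A`. -/
structure IsOneParameterGroup (σ : ℝ → (A →⋆ₙₐ[ℂ] A)) : Prop where
  map_zero : ∀ a, σ 0 a = a
  map_add : ∀ s t a, σ (s + t) a = σ s (σ t a)
  continuous : ∀ a, Continuous fun t => σ t a

/-- `b = σ_{i/2}(a)`: there is a continuous function on the strip `0 ≤ Im z ≤ 1/2`, analytic in its
interior, with boundary values `t ↦ σ_t(a)` on the real line and with value `b` at `i/2`. -/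
def IsHalfImaginaryValue (σ : ℝ → (A →⋆ₙₐ[ℂ] A)) (a b : A) : Prop :=
  ∃ f : ℂ → A, ContinuousOn f {z | 0 ≤ z.im ∧ z.im ≤ 1 / 2} ∧
    DifferentiableOn ℂ f {z | 0 < z.im ∧ z.im < 1 / 2} ∧
    (∀ t : ℝ, f t = σ t a) ∧ f (Complex.I / 2) = b

/-- A faithful KMS weight `φ : A₊ → [0, ∞]`: additive, positively homogeneous, faithful, lower
semicontinuous, densely defined, and satisfying the KMS condition `φ(a* a) = φ(σ_{i/2}(a) σ_{i/2}(a)*)`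
for some norm-continuous one-parameter group `σ` leaving `φ` invariant. Values of
`φ` outside the positive cone are irrelevant. -/
structure IsFaithfulKMSWeight (φ : A → ℝ≥0∞) : Prop where
  map_add : ∀ a b, 0 ≤ a → 0 ≤ b → φ (a + b) = φ a + φ b
  map_smul : ∀ (r : ℝ) (a : A), 0 ≤ r → 0 ≤ a → φ ((r : ℂ) • a) = ENNReal.ofReal r * φ a
  faithful : ∀ a, 0 ≤ a → φ a = 0 → a = 0
  lowerSemicontinuous : LowerSemicontinuousOn φ {a | 0 ≤ a}
  denselyDefined : {a : A | 0 ≤ a} ⊆ closure {a | 0 ≤ a ∧ φ a < ∞}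
  kms : ∃ σ : ℝ → (A →⋆ₙₐ[ℂ] A), IsOneParameterGroup σ ∧
    (∀ t a, 0 ≤ a → φ (σ t a) = φ a) ∧
    ∀ a b, IsHalfImaginaryValue σ a b → φ (star a * a) = φ (b * star b)

end Weights

/-- A C⋆-algebra `A` with a comultiplication. The algebra is given with a faithful nondegenerate
representation `rep` on a Hilbert space, in which `A ⊗ A` and `M(A ⊗ A)` are realised, and the
comultiplication is a nondegenerate coassociative `*`-homomorphism `Δ : A → M(A ⊗ A)`. -/
structure Comultiplication (A : Type u) [NonUnitalCStarAlgebra A]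
    (H : Type v) [NormedAddCommGroup H] [InnerProductSpace ℂ H] [CompleteSpace H] where
  rep : A →⋆ₙₐ[ℂ] (H →L[ℂ] H)
  rep_injective : Function.Injective rep
  rep_nondegenerate : Dense (Submodule.span ℂ {ζ : H | ∃ a η, ζ = rep a η} : Set H)
  comul : A →⋆ₙₐ[ℂ] (HilbertTensor H H →L[ℂ] HilbertTensor H H)
  comul_mem : ∀ a, comul a ∈ multiplierAlgebra (spatialTensor rep)
  comul_nondegenerate :
    (Submodule.span ℂ {T | ∃ a, ∃ d ∈ spatialTensor rep, T = comul a * d}).topologicalClosure =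
      spatialTensor rep
  /-- `(Δ ⊗ id) Δ = (id ⊗ Δ) Δ`, as operators on the threefold tensor product of `H`; the two ways of
  bracketing it are identified on elementary tensors. -/
  coassoc : ∀ a, ∃ S₁ S₂,
    IsStrictImage (tensorHom rep comul rep) ⟨comul a, comul_mem a⟩ S₁ ∧
    IsStrictImage (tensorHom rep rep comul) ⟨comul a, comul_mem a⟩ S₂ ∧
    ∀ ξ₁ ξ₂ ξ₃ η₁ η₂ η₃ : H,
      ⟪hTmul (hTmul ξ₁ ξ₂) ξ₃, S₁ (hTmul (hTmul η₁ η₂) η₃)⟫_ℂ =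
        ⟪hTmul ξ₁ (hTmul ξ₂ ξ₃), S₂ (hTmul η₁ (hTmul η₂ η₃))⟫_ℂ

namespace Comultiplication

variable {A : Type u} [NonUnitalCStarAlgebra A]
  {H : Type v} [NormedAddCommGroup H] [InnerProductSpace ℂ H] [CompleteSpace H]

/-- `Δ(a)` as an element of `M(A ⊗ A)`. -/
def Δ (G : Comultiplication A H) (a : A) : multiplierAlgebra (spatialTensor G.rep) :=
  ⟨G.comul a, G.comul_mem a⟩

/-- The convolution product `ω ⋆ μ = (ω ⊗ μ) ∘ Δ` of bounded functionals. -/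
def conv (G : Comultiplication A H) (ω μ : StrongDual ℂ A) (a : A) : ℂ :=
  strictExt (tensorFunctional G.rep ω μ) (G.Δ a)

/-- `b = (ω ⊗ id) Δ(a)`. -/
def IsLeftSlice (G : Comultiplication A H) (ω : StrongDual ℂ A) (a b : A) : Prop :=
  ∀ ν : StrongDual ℂ A, ν b = G.conv ω ν a

/-- `b = (id ⊗ ω) Δ(a)`. -/
def IsRightSlice (G : Comultiplication A H) (ω : StrongDual ℂ A) (a b : A) : Prop :=
  ∀ ν : StrongDual ℂ A, ν b = G.conv ν ω a

/-- Left invariance of a weight: `φ((ω ⊗ id)Δ(a)) = ω(1) φ(a)` for positive `ω`, and positive `a` with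
`φ(a) < ∞`; here `ω(1) = ‖ω‖`. -/
def IsLeftInvariant [PartialOrder A] (G : Comultiplication A H) (φ : A → ℝ≥0∞) : Prop :=
  ∀ (ω : StrongDual ℂ A) (a b : A), IsPositiveFunctional ω → 0 ≤ a → φ a < ∞ →
    G.IsLeftSlice ω a b → φ b = ENNReal.ofReal ‖ω‖ * φ a

/-- Right invariance of a weight: `φ((id ⊗ ω)Δ(a)) = ω(1) φ(a)` for positive `ω`, and positive `a`
with `φ(a) < ∞`; here `ω(1) = ‖ω‖`. -/
def IsRightInvariant [PartialOrder A] (G : Comultiplication A H) (φ : A → ℝ≥0∞) : Prop :=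
  ∀ (ω : StrongDual ℂ A) (a b : A), IsPositiveFunctional ω → 0 ≤ a → φ a < ∞ →
    G.IsRightSlice ω a b → φ b = ENNReal.ofReal ‖ω‖ * φ a

/-- Coamenability: there is a bounded counit, `(ε ⊗ id)Δ = id = (id ⊗ ε)Δ`. -/
def IsCoamenable (G : Comultiplication A H) : Prop :=
  ∃ ε : StrongDual ℂ A, ∀ a, G.IsLeftSlice ε a a ∧ G.IsRightSlice ε a a

/-- A contractive idempotent functional. -/
structure IsContractiveIdempotent (G : Comultiplication A H) (ω : StrongDual ℂ A) : Prop where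
  ne_zero : ω ≠ 0
  idempotent : ∀ a, G.conv ω ω a = ω a
  contractive : ‖ω‖ ≤ 1

end Comultiplication

/-- A locally compact quantum group `𝔾` with `A = C₀(𝔾)`: the comultiplication satisfies the
quantum cancellation laws, and there are a left and a right Haar weight. -/
structure LocallyCompactQuantumGroup (A : Type u) [NonUnitalCStarAlgebra A] [PartialOrder A]
    [StarOrderedRing A] (H : Type v) [NormedAddCommGroup H] [InnerProductSpace ℂ H]
    [CompleteSpace H] extends Comultiplication A H where
  cancel_left :
    (Submodule.span ℂ {T | ∃ a b, T = comul a * opTensor (rep b) 1}).topologicalClosure =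
      spatialTensor rep
  cancel_right :
    (Submodule.span ℂ {T | ∃ a b, T = comul a * opTensor 1 (rep b)}).topologicalClosure =
      spatialTensor rep
  exists_leftHaarWeight :
    ∃ φ : A → ℝ≥0∞, IsFaithfulKMSWeight φ ∧ toComultiplication.IsLeftInvariant φ
  exists_rightHaarWeight :
    ∃ ψ : A → ℝ≥0∞, IsFaithfulKMSWeight ψ ∧ toComultiplication.IsRightInvariant ψ

section Compact

variable {A : Type u} [NonUnitalCStarAlgebra A] [PartialOrder A] [StarOrderedRing A]
  {H : Type v} [NormedAddCommGroup H] [InnerProductSpace ℂ H] [CompleteSpace H]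
  {B : Type u'} [CStarAlgebra B] [PartialOrder B] [StarOrderedRing B]
  {K : Type w} [NormedAddCommGroup K] [InnerProductSpace ℂ K] [CompleteSpace K]

/-- `h` is the Haar state of the compact quantum group `ℍ` (the algebra `B = C(ℍ)` is unital): a state
with `(h ⊗ id)Δ(a) = h(a) 1 = (id ⊗ h)Δ(a)`. -/
structure IsHaarState (ℍ : LocallyCompactQuantumGroup B K) (h : StrongDual ℂ B) : Prop where
  positive : IsPositiveFunctional h
  map_one : h 1 = 1
  left_invariant : ∀ a, ℍ.IsRightSlice h a (h a • 1)
  right_invariant : ∀ a, ℍ.IsLeftSlice h a (h a • 1)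

/-- `(ℍ, π)` is a compact quantum subgroup of `𝔾`: `π : C₀(𝔾) → C(ℍ)` is a surjective
`*`-homomorphism with `(π ⊗ π) Δ_𝔾 = Δ_ℍ π`. -/
structure IsCompactQuantumSubgroup (𝔾 : LocallyCompactQuantumGroup A H)
    (ℍ : LocallyCompactQuantumGroup B K) (π : A →⋆ₙₐ[ℂ] B) : Prop where
  surjective : Function.Surjective π
  intertwines : ∀ a, IsStrictImage (tensorHom 𝔾.rep (ℍ.rep.comp π) (ℍ.rep.comp π)) (𝔾.Δ a)
    (ℍ.comul (π a))

/-- A unitary `u ∈ C(ℍ)` is group-like if `Δ(u) = u ⊗ u`. -/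
structure IsGroupLikeUnitary (ℍ : LocallyCompactQuantumGroup B K) (u : B) : Prop where
  unitary : u ∈ unitary B
  comul_eq : ℍ.comul u = opTensor (ℍ.rep u) (ℍ.rep u)

end Compact

end
end QuantumGroup

/-! Let `θ`, `ξ` be the GNS representation of the Haar state `h` of `ℍ`, and let `δ` be the
comultiplication of `ℍ` carried to the tensor square of `θ`. The left Haar weight is faithful and,
`B` being unital, finite; invariance then makes `h` faithful, so `ξ` is separating
(`IsHaarState.faithful`, `IsHaarState.isHaarRepresentation`).

Extending `θ ∘ π` to the bidual, the polar decomposition `ω = v.|ω|_r` with `|ω|_r = h ∘ π` becomes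
`ω a = ⟪ξ, θ (π a) η⟫`, where `η = v ξ` and `‖η‖ ≤ 1`. Invariance of `h` makes `V : θ b ξ ↦ δ b (ξ ⊗
ξ)` an isometry, and idempotency of `ω` says `V* (η ⊗ η) = η`. Hence `‖V η - η ⊗ η‖² = ‖η‖⁴ - ‖η‖²`.
The left side is nonnegative, and the right side is nonpositive since `‖η‖ ≤ 1`; as `η ≠ 0`, this
forces `‖η‖ = 1` and `V η = η ⊗ η` (`tendsto_apply_hTmul`).

The vector `η` comes from an element of `B`. If `θ (b n) ξ → η`, then slicing the second leg of `δ
(b n)` with the pair `η`, `ξ` gives elements of `B` that are Cauchy in norm, because `‖δ b (y ⊗ ξ)‖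
= ‖θ b ξ‖ ‖y‖`. Their limit `u` satisfies `θ u ξ = η`, and `δ u` agrees with `θ u ⊗ θ u` on the
separating vector `ξ ⊗ ξ`, so `u` is group-like (`exists_groupLike`). Applying invariance to the
group-like elements `u* u` and `u u*` shows that both are `1` (`mem_unitary`). Finally `|ω|_l` is
the functional of `η = θ u ξ`, that is `h (u* · u)` pulled back by `π`, and invariance on both legs
gives `h (u* b u) = h b` (`inner_groupLike`). -/

namespace QuantumGroup

noncomputable section

set_option linter.unusedSectionVars false

/-! ### Spatial tensor products: homomorphisms on them, slices, separating vectors. -/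

section SpatialTensor

variable {A : Type*} [NonUnitalCStarAlgebra A]
  {H : Type*} [NormedAddCommGroup H] [InnerProductSpace ℂ H] [CompleteSpace H]
  {L : Type*} [NormedAddCommGroup L] [InnerProductSpace ℂ L] [CompleteSpace L]
  {K : Type*} [NormedAddCommGroup K] [InnerProductSpace ℂ K] [CompleteSpace K]

theorem hTmul_ext {F : Type*} [NormedAddCommGroup F] [NormedSpace ℂ F]
    {S T : HilbertTensor H K →L[ℂ] F} (h : ∀ x y, S (hTmul x y) = T (hTmul x y)) : S = T := by
  refine op_ext fun z => ?_
  induction z with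
  | zero => simp
  | add x y hx hy => simp only [map_add, hx, hy]
  | tmul x y => exact h x y

theorem hTmul_inner_ext {x y : HilbertTensor H K}
    (h : ∀ a b, ⟪hTmul a b, x⟫_ℂ = ⟪hTmul a b, y⟫_ℂ) : x = y := by
  have : innerSL ℂ x = innerSL ℂ y := hTmul_ext fun a b => by
    have := congrArg star (h a b)
    simpa using this
  exact (innerSL ℂ).toLinearMap.ker_eq_bot.1 (by
    rw [LinearMap.ker_eq_bot]; intro a b hab
    exact ext_inner_right ℂ fun v => by
      simpa using congrArg (fun f : StrongDual ℂ (HilbertTensor H K) => f v) hab) this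

theorem norm_hTmul (x : H) (y : K) : ‖hTmul x y‖ = ‖x‖ * ‖y‖ := by simp [hTmul]

/-- The operator `x ↦ x ⊗ y`. -/
def tmulRight (y : K) : H →L[ℂ] HilbertTensor H K :=
  LinearMap.mkContinuous
    { toFun := fun x => hTmul x y
      map_add' := fun a b =>
        (congrArg ofAlg (TensorProduct.add_tmul a b y)).trans (ofAlg.map_add _ _)
      map_smul' := fun c a => ofAlg.map_smul c (a ⊗ₜ y) } ‖y‖
    fun x => (norm_hTmul x y).le.trans_eq (mul_comm _ _)

/-- The operator `y ↦ x ⊗ y`. -/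
def tmulLeft (x : H) : K →L[ℂ] HilbertTensor H K :=
  LinearMap.mkContinuous
    { toFun := fun y => hTmul x y
      map_add' := fun a b =>
        (congrArg ofAlg (TensorProduct.tmul_add x a b)).trans (ofAlg.map_add _ _)
      map_smul' := fun c a =>
        (congrArg ofAlg (TensorProduct.tmul_smul c x a)).trans (ofAlg.map_smul _ _) } ‖x‖
    fun y => (norm_hTmul x y).le

@[simp] theorem tmulRight_apply (x : H) (y : K) : tmulRight y x = hTmul x y := rfl

@[simp] theorem tmulLeft_apply (x : H) (y : K) : tmulLeft x y = hTmul x y := rfl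

theorem norm_tmulRight_le (y : K) : ‖(tmulRight y : H →L[ℂ] HilbertTensor H K)‖ ≤ ‖y‖ :=
  LinearMap.mkContinuous_norm_le _ (norm_nonneg _) _

theorem opTensor_one : opTensor (1 : H →L[ℂ] H) (1 : K →L[ℂ] K) = 1 :=
  hTmul_ext fun x y => by simp [opTensor_hTmul]

theorem opTensor_star (S : H →L[ℂ] H) (T : K →L[ℂ] K) :
    star (opTensor S T) = opTensor (star S) (star T) := by
  rw [ContinuousLinearMap.star_eq_adjoint, eq_comm, ContinuousLinearMap.eq_adjoint_iff]
  exact opTensor_star_inner _ _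

variable (ρ : A →⋆ₙₐ[ℂ] (H →L[ℂ] H))

theorem coe_algToSpatial (x : A ⊗[ℂ] A) :
    (algToSpatial ρ x : HilbertTensor H H →L[ℂ] HilbertTensor H H) = algTensorHom ρ ρ x := rfl

theorem algTensorHom_mem_spatialTensor (x : A ⊗[ℂ] A) : algTensorHom ρ ρ x ∈ spatialTensor ρ :=
  (algToSpatial ρ x).2

theorem isClosed_spatialTensor :
    IsClosed (spatialTensor ρ : Set (HilbertTensor H H →L[ℂ] HilbertTensor H H)) :=
  Submodule.isClosed_topologicalClosure _

variable {ρ}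

theorem spatialTensor_mul_mem {x y : HilbertTensor H H →L[ℂ] HilbertTensor H H}
    (hx : x ∈ spatialTensor ρ) (hy : y ∈ spatialTensor ρ) : x * y ∈ spatialTensor ρ := by
  obtain ⟨⟨x, rfl⟩, ⟨y, rfl⟩⟩ : (∃ x' : spatialTensor ρ, x'.1 = x) ∧
      ∃ y' : spatialTensor ρ, y'.1 = y := ⟨⟨⟨x, hx⟩, rfl⟩, ⟨⟨y, hy⟩, rfl⟩⟩
  clear hx hy
  induction x, y using (denseRange_algToSpatial ρ).induction_on₂ with
  | hp =>
      exact IsClosed.preimage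
        (f := fun p : spatialTensor ρ × spatialTensor ρ => p.1.1 * p.2.1) (by fun_prop)
        (isClosed_spatialTensor ρ)
  | h x y =>
    rw [coe_algToSpatial, coe_algToSpatial, ← algTensorHom_mul]
    exact algTensorHom_mem_spatialTensor _ _

theorem spatialTensor_star_mem {x : HilbertTensor H H →L[ℂ] HilbertTensor H H}
    (hx : x ∈ spatialTensor ρ) : star x ∈ spatialTensor ρ := by
  obtain ⟨x, rfl⟩ : ∃ x' : spatialTensor ρ, x'.1 = x := ⟨⟨x, hx⟩, rfl⟩
  clear hx
  induction x using (denseRange_algToSpatial ρ).induction_on with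
  | hp =>
      exact IsClosed.preimage
        (f := fun p : spatialTensor ρ => star p.1) (by fun_prop)
        (isClosed_spatialTensor ρ)
  | ih x =>
    rw [coe_algToSpatial, ← algTensorHom_star]
    exact algTensorHom_mem_spatialTensor _ _

variable (hρ : Function.Injective ρ) (θ₁ : A →⋆ₙₐ[ℂ] (L →L[ℂ] L)) (θ₂ : A →⋆ₙₐ[ℂ] (K →L[ℂ] K))
include hρ

theorem tensorHom_mul {x y z : spatialTensor ρ} (h : (z : HilbertTensor H H →L[ℂ] _) = x.1 * y.1) :
    tensorHom ρ θ₁ θ₂ z = tensorHom ρ θ₁ θ₂ x * tensorHom ρ θ₁ θ₂ y := by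
  obtain rfl : z = ⟨x.1 * y.1, spatialTensor_mul_mem x.2 y.2⟩ := Subtype.ext h
  clear h
  induction x, y using (denseRange_algToSpatial ρ).induction_on₂ with
  | hp => exact isClosed_eq (by fun_prop) (by fun_prop)
  | h x y =>
    rw [tensorHom_algToSpatial ρ hρ, tensorHom_algToSpatial ρ hρ, ← algTensorHom_mul,
      ← tensorHom_algToSpatial ρ hρ]
    congr 1
    ext1
    exact (algTensorHom_mul ρ ρ x y).symm

theorem tensorHom_star {x z : spatialTensor ρ} (h : (z : HilbertTensor H H →L[ℂ] _) = star x.1) :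
    tensorHom ρ θ₁ θ₂ z = star (tensorHom ρ θ₁ θ₂ x) := by
  obtain rfl : z = ⟨star x.1, spatialTensor_star_mem x.2⟩ := Subtype.ext h
  clear h
  induction x using (denseRange_algToSpatial ρ).induction_on with
  | hp => exact isClosed_eq (by fun_prop) (by fun_prop)
  | ih x =>
    rw [tensorHom_algToSpatial ρ hρ, ← algTensorHom_star, ← tensorHom_algToSpatial ρ hρ]
    congr 1
    ext1
    exact (algTensorHom_star ρ ρ x).symm

/-- The bound `norm_algTensorHom_le` holds with `ρ` and `θ` in either role, since both are faithful.
So the spatial norm does not depend on the faithful representation. -/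
theorem norm_tensorHom (θ : A →⋆ₙₐ[ℂ] (L →L[ℂ] L)) (hθ : Function.Injective θ)
    (x : spatialTensor ρ) : ‖tensorHom ρ θ θ x‖ = ‖x‖ := by
  induction x using (denseRange_algToSpatial ρ).induction_on with
  | hp => exact isClosed_eq (by fun_prop) (by fun_prop)
  | ih x =>
    rw [tensorHom_algToSpatial ρ hρ]
    exact le_antisymm (norm_algTensorHom_le ρ hρ θ θ x) (norm_algTensorHom_le θ hθ ρ ρ x)

theorem tensorHom_injective (θ : A →⋆ₙₐ[ℂ] (L →L[ℂ] L)) (hθ : Function.Injective θ) :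
    Function.Injective (tensorHom ρ θ θ) :=
  (injective_iff_map_eq_zero _).2 fun x hx => by
    rw [← norm_eq_zero, ← norm_tensorHom hρ θ hθ, hx, norm_zero]

theorem tensorHom_mem_spatialTensor {B : Type*} [NonUnitalCStarAlgebra B]
    (θ : B →⋆ₙₐ[ℂ] (L →L[ℂ] L)) (π : A →⋆ₙₐ[ℂ] B) (x : spatialTensor ρ) :
    tensorHom ρ (θ.comp π) (θ.comp π) x ∈ spatialTensor θ := by
  induction x using (denseRange_algToSpatial ρ).induction_on with
  | hp => exact (isClosed_spatialTensor θ).preimage (by fun_prop)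
  | ih x =>
    rw [tensorHom_algToSpatial ρ hρ]
    induction x with
    | zero => simp
    | add x y hx hy => rw [map_add]; exact Submodule.add_mem _ hx hy
    | tmul a b => exact algTensorHom_mem_spatialTensor θ (π a ⊗ₜ π b)

/-- Representations of the tensor square of a quotient, pulled back. -/
theorem tensorHom_comp {B : Type*} [NonUnitalCStarAlgebra B]
    {σ : B →⋆ₙₐ[ℂ] (K →L[ℂ] K)} (hσ : Function.Injective σ)
    (θ : B →⋆ₙₐ[ℂ] (L →L[ℂ] L)) (π : A →⋆ₙₐ[ℂ] B) (x : spatialTensor ρ) (y : spatialTensor σ)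
    (h : y.1 = tensorHom ρ (σ.comp π) (σ.comp π) x) :
    tensorHom σ θ θ y = tensorHom ρ (θ.comp π) (θ.comp π) x := by
  obtain rfl : y = ⟨_, tensorHom_mem_spatialTensor hρ σ π x⟩ := Subtype.ext h
  clear h
  induction x using (denseRange_algToSpatial ρ).induction_on with
  | hp => exact isClosed_eq (by fun_prop) (by fun_prop)
  | ih x =>
    have : (⟨_, tensorHom_mem_spatialTensor hρ σ π (algToSpatial ρ x)⟩ : spatialTensor σ) =
        algToSpatial σ (TensorProduct.map (π : A →ₗ[ℂ] B) (π : A →ₗ[ℂ] B) x) := by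
      ext1
      simp only [tensorHom_algToSpatial ρ hρ, coe_algToSpatial]
      induction x with
      | zero => simp
      | add x y hx hy => simp only [map_add, hx, hy]
      | tmul a b => rfl
    rw [this, tensorHom_algToSpatial ρ hρ, tensorHom_algToSpatial σ hσ]
    clear this
    induction x with
    | zero => simp
    | add x y hx hy => simp only [map_add, hx, hy]
    | tmul a b => rfl

/-- This turns convolution of coefficient functionals into a matrix coefficient, so that everything
afterwards is done with vectors and operators. -/
theorem tensorFunctional_coeff (a c : L) (b d : K) (x : spatialTensor ρ) :
    tensorFunctional ρ (coeff θ₁ a c) (coeff θ₂ b d) x =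
      ⟪hTmul a b, tensorHom ρ θ₁ θ₂ x (hTmul c d)⟫_ℂ := by
  induction x using (denseRange_algToSpatial ρ).induction_on with
  | hp => exact isClosed_eq (by fun_prop) (by fun_prop)
  | ih x =>
    rw [tensorFunctional_algToSpatial ρ hρ, tensorHom_algToSpatial ρ hρ, inner_algTensorHom]

omit hρ

theorem isClosed_range_rep (hρ : Function.Injective ρ) : IsClosed (Set.range ρ) :=
  (NonUnitalStarAlgHom.isometry ρ hρ).isClosedEmbedding.isClosed_range

/-- A right slice of an element of the spatial tensor product belongs to the algebra. -/
theorem exists_rightSlice (hρ : Function.Injective ρ)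
    {T : HilbertTensor H H →L[ℂ] HilbertTensor H H} (hT : T ∈ spatialTensor ρ) (ζ ζ' : H) :
    ∃ a, ρ a = (tmulRight ζ).adjoint ∘L T ∘L tmulRight ζ' := by
  obtain ⟨T, rfl⟩ : ∃ x' : spatialTensor ρ, x'.1 = T := ⟨⟨T, hT⟩, rfl⟩
  clear hT
  -- The slice map is continuous and the range of the isometry `ρ` is closed, so algebraic tensors
  -- suffice.
  induction T using (denseRange_algToSpatial ρ).induction_on with
  | hp =>
      exact IsClosed.preimage
        (f := fun p : spatialTensor ρ => (tmulRight ζ).adjoint ∘L p.1 ∘L tmulRight ζ') (by fun_prop)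
        (isClosed_range_rep hρ)
  | ih x =>
    rw [coe_algToSpatial]
    induction x with
    | zero => exact ⟨0, by simp⟩
    | add x y hx hy =>
      obtain ⟨a, ha⟩ := hx
      obtain ⟨b, hb⟩ := hy
      exact ⟨a + b, by simp [ha, hb]⟩
    | tmul a b =>
      refine ⟨⟪ζ, ρ b ζ'⟫_ℂ • a, ?_⟩
      ext y
      refine ext_inner_left ℂ fun x => ?_
      simp [ContinuousLinearMap.adjoint_inner_right, algTensorHom_tmul, opTensor_hTmul,
        inner_hTmul, mul_comm]

/-- A left slice of an element of the spatial tensor product belongs to the algebra. -/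
theorem exists_leftSlice (hρ : Function.Injective ρ)
    {T : HilbertTensor H H →L[ℂ] HilbertTensor H H} (hT : T ∈ spatialTensor ρ) (ζ ζ' : H) :
    ∃ a, ρ a = (tmulLeft ζ).adjoint ∘L T ∘L tmulLeft ζ' := by
  obtain ⟨T, rfl⟩ : ∃ x' : spatialTensor ρ, x'.1 = T := ⟨⟨T, hT⟩, rfl⟩
  clear hT
  induction T using (denseRange_algToSpatial ρ).induction_on with
  | hp =>
      exact IsClosed.preimage
        (f := fun p : spatialTensor ρ => (tmulLeft ζ).adjoint ∘L p.1 ∘L tmulLeft ζ') (by fun_prop)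
        (isClosed_range_rep hρ)
  | ih x =>
    rw [coe_algToSpatial]
    induction x with
    | zero => exact ⟨0, by simp⟩
    | add x y hx hy =>
      obtain ⟨a, ha⟩ := hx
      obtain ⟨b, hb⟩ := hy
      exact ⟨a + b, by simp [ha, hb]⟩
    | tmul a b =>
      refine ⟨⟪ζ, ρ a ζ'⟫_ℂ • b, ?_⟩
      ext y
      refine ext_inner_left ℂ fun x => ?_
      simp [ContinuousLinearMap.adjoint_inner_right, algTensorHom_tmul, opTensor_hTmul,
        inner_hTmul]

/-- If `ξ` is separating for `A`, then `ξ ⊗ ξ` is separating for `A ⊗ A`. -/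
theorem eq_zero_of_apply_hTmul (hρ : Function.Injective ρ) {ξ : H}
    (hξ : ∀ a, ρ a ξ = 0 → a = 0) {T : HilbertTensor H H →L[ℂ] HilbertTensor H H}
    (hT : T ∈ spatialTensor ρ) (h : T (hTmul ξ ξ) = 0) : T = 0 := by
  -- Each right slice of `T` against the pair `z`, `ξ` is an element of the algebra that kills `ξ`,
  -- hence vanishes. This frees the first leg; left slices then free the second.
  have h1 : ∀ y, T (hTmul y ξ) = 0 := fun y => hTmul_inner_ext fun x z => by
    obtain ⟨a, ha⟩ := exists_rightSlice hρ hT z ξ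
    have : a = 0 := hξ a (by rw [ha]; simp [h])
    have h2 := congrArg (fun S : H →L[ℂ] H => ⟪x, S y⟫_ℂ) ha
    simp only [this, map_zero, ContinuousLinearMap.comp_apply,
      ContinuousLinearMap.adjoint_inner_right, tmulRight_apply] at h2
    rw [← h2]; simp
  refine hTmul_ext fun y w => hTmul_inner_ext fun z x => ?_
  obtain ⟨a, ha⟩ := exists_leftSlice hρ hT z y
  have : a = 0 := hξ a (by rw [ha]; simp [h1])
  have h2 := congrArg (fun S : H →L[ℂ] H => ⟪x, S w⟫_ℂ) ha
  simp only [this, map_zero, ContinuousLinearMap.comp_apply,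
    ContinuousLinearMap.adjoint_inner_right, tmulLeft_apply] at h2
  rw [← h2]; simp

end SpatialTensor

/-! ### The strict topology: approximate units and strict extension. -/

section Strict

variable {A : Type*} [NonUnitalCStarAlgebra A]
  {H : Type*} [NormedAddCommGroup H] [InnerProductSpace ℂ H] [CompleteSpace H]
  {L : Type*} [NormedAddCommGroup L] [InnerProductSpace ℂ L] [CompleteSpace L]

theorem exists_approximateUnit (C : Type*) [NonUnitalCStarAlgebra C] :
    ∃ l : Filter C, l.NeBot ∧ (∀ᶠ e in l, ‖e‖ ≤ 1) ∧
      ∀ d, Tendsto (fun e => e * d) l (𝓝 d) ∧ Tendsto (fun e => d * e) l (𝓝 d) := by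
  let := CStarAlgebra.spectralOrder C
  have := CStarAlgebra.spectralOrderedRing C
  have h := CStarAlgebra.increasingApproximateUnit C
  exact ⟨_, h.neBot, h.eventually_norm, fun d => ⟨h.tendsto_mul_right d, h.tendsto_mul_left d⟩⟩

/-- The spatial tensor product as a C⋆-subalgebra. -/
def spatialTensorSubalgebra (ρ : A →⋆ₙₐ[ℂ] (H →L[ℂ] H)) :
    NonUnitalStarSubalgebra ℂ (HilbertTensor H H →L[ℂ] HilbertTensor H H) where
  __ := spatialTensor ρ
  mul_mem' := spatialTensor_mul_mem
  star_mem' := spatialTensor_star_mem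

/-- A contractive approximate unit of the spatial tensor product is finer than this filter. Without
this, the `limUnder` in `strictExt` could not be computed from a `Tendsto` statement. -/
instance strictUnitFilter_neBot (ρ : A →⋆ₙₐ[ℂ] (H →L[ℂ] H)) :
    (strictUnitFilter (spatialTensor ρ)).NeBot := by
  have : IsClosed (spatialTensorSubalgebra ρ : Set (HilbertTensor H H →L[ℂ] HilbertTensor H H)) :=
    isClosed_spatialTensor ρ
  obtain ⟨l, hl, h1, h2⟩ := exists_approximateUnit (spatialTensorSubalgebra ρ)
  let f : spatialTensorSubalgebra ρ → spatialTensor ρ := fun e => ⟨e.1, e.2⟩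
  have : map f l ≤ strictUnitFilter (spatialTensor ρ) := by
    refine le_inf (le_principal_iff.2 h1) (le_iInf fun d => ?_)
    rw [← tendsto_iff_comap]
    have := h2 ⟨d.1, d.2⟩
    have h3 := (continuous_subtype_val.tendsto _).comp this.1
    have h4 := (continuous_subtype_val.tendsto _).comp this.2
    have h5 := (h3.sub_const d.1).prodMk_nhds (h4.sub_const d.1)
    rw [sub_self] at h5
    exact h5
  exact NeBot.mono (hl.map f) this

theorem tendsto_mul_strictUnitFilter (D : Submodule ℂ (L →L[ℂ] L)) (d : D) :
    Tendsto (fun e : D => (e : L →L[ℂ] L) * (d : L →L[ℂ] L)) (strictUnitFilter D) (𝓝 d) := by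
  have h : Tendsto (fun e : D =>
      ((e : L →L[ℂ] L) * (d : L →L[ℂ] L) - d, (d : L →L[ℂ] L) * (e : L →L[ℂ] L) - d))
      (strictUnitFilter D) (𝓝 0) :=
    tendsto_iff_comap.2 (inf_le_right.trans (iInf_le _ d))
  have := ((continuous_fst.tendsto _).comp h).add_const (d : L →L[ℂ] L)
  simpa [Function.comp_def] using this

/-- Over an algebra containing the identity operator, strict extension is evaluation. -/
theorem strictExt_of_one_mem {D : Submodule ℂ (L →L[ℂ] L)} (h1 : (1 : L →L[ℂ] L) ∈ D)
    [(strictUnitFilter D).NeBot] (F : StrongDual ℂ D) (T : multiplierAlgebra D) (hT : T.1 ∈ D) :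
    strictExt F T = F ⟨T.1, hT⟩ := by
  refine Tendsto.limUnder_eq ?_
  -- Testing strict convergence against `d = 1` gives norm convergence to `1`.
  have h : Tendsto (fun e : D => e) (strictUnitFilter D) (𝓝 ⟨1, h1⟩) := by
    rw [tendsto_subtype_rng]
    simpa using tendsto_mul_strictUnitFilter D ⟨1, h1⟩
  refine (F.continuous.tendsto _).comp ?_
  rw [tendsto_subtype_rng]
  have := ((continuous_subtype_val.tendsto _).comp h).const_mul T.1
  simpa [multiplierMul, Function.comp_def] using this

end Strict

/-! ### Unital comultiplications, and convolution through a compact quantum subgroup. -/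

section Compact

variable {A : Type*} [NonUnitalCStarAlgebra A] [PartialOrder A] [StarOrderedRing A]
  {H : Type*} [NormedAddCommGroup H] [InnerProductSpace ℂ H] [CompleteSpace H]
  {B : Type*} [CStarAlgebra B] [PartialOrder B] [StarOrderedRing B]
  {K : Type*} [NormedAddCommGroup K] [InnerProductSpace ℂ K] [CompleteSpace K]
  {L : Type*} [NormedAddCommGroup L] [InnerProductSpace ℂ L] [CompleteSpace L]

namespace Comultiplication

variable (G : Comultiplication B K)

theorem rep_one : G.rep 1 = 1 := by
  have : Set.EqOn (G.rep 1) (ContinuousLinearMap.id ℂ K)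
      {ζ : K | ∃ a η, ζ = G.rep a η} := by
    rintro _ ⟨a, η, rfl⟩
    rw [← mul_apply_eq_comp, ← map_mul, one_mul]; rfl
  exact ContinuousLinearMap.ext_on G.rep_nondegenerate this

theorem one_mem_spatialTensor : 1 ∈ spatialTensor G.rep := by
  have := algTensorHom_mem_spatialTensor G.rep (1 ⊗ₜ 1)
  rwa [algTensorHom_tmul, rep_one, opTensor_one] at this

/-- The unit lies in the tensor square, so multipliers are already elements of it. Representations
can thus be applied to `G.comul b` directly, with no strict extension. -/
theorem comul_mem_spatialTensor (b : B) : G.comul b ∈ spatialTensor G.rep := by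
  simpa using (G.comul_mem b 1 G.one_mem_spatialTensor).1

/-- The comultiplication of a unital algebra, with values in the tensor square of another
representation. -/
def comulIn (θ : B →⋆ₙₐ[ℂ] (L →L[ℂ] L)) :
    B →⋆ₙₐ[ℂ] (HilbertTensor L L →L[ℂ] HilbertTensor L L) where
  toFun b := tensorHom G.rep θ θ ⟨G.comul b, G.comul_mem_spatialTensor b⟩
  map_smul' c b := by
    rw [← map_smul]; congr 1; ext1; simp
  map_zero' := by
    rw [← map_zero (tensorHom G.rep θ θ)]; congr 1; ext1; simp
  map_add' a b := by
    rw [← map_add]; congr 1; ext1; simp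
  map_mul' a b := tensorHom_mul G.rep_injective θ θ (map_mul G.comul a b)
  map_star' b := tensorHom_star G.rep_injective θ θ (map_star G.comul b)

theorem comulIn_mem_spatialTensor (θ : B →⋆ₙₐ[ℂ] (L →L[ℂ] L)) (b : B) :
    G.comulIn θ b ∈ spatialTensor θ :=
  tensorHom_mem_spatialTensor G.rep_injective θ (NonUnitalStarAlgHom.id ℂ B) _

theorem conv_coeff (θ : B →⋆ₙₐ[ℂ] (L →L[ℂ] L)) (x y z w : L) (b : B) :
    G.conv (coeff θ x y) (coeff θ z w) b = ⟪hTmul x z, G.comulIn θ b (hTmul y w)⟫_ℂ := by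
  rw [conv, strictExt_of_one_mem G.one_mem_spatialTensor _ _ (G.comul_mem_spatialTensor b),
    tensorFunctional_coeff G.rep_injective]
  rfl

/-- Returns the group-like identity from the GNS space to the given representation, `tensorHom`
being isometric when `θ` is faithful. -/
theorem comul_eq_of_comulIn_eq {θ : B →⋆ₙₐ[ℂ] (L →L[ℂ] L)} (hθ : Function.Injective θ) {u : B}
    (h : G.comulIn θ u = opTensor (θ u) (θ u)) : G.comul u = opTensor (G.rep u) (G.rep u) := by
  have : (⟨G.comul u, G.comul_mem_spatialTensor u⟩ : spatialTensor G.rep) =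
      algToSpatial G.rep (u ⊗ₜ u) := by
    refine tensorHom_injective G.rep_injective θ hθ ?_
    rw [tensorHom_algToSpatial G.rep G.rep_injective]
    exact h
  exact congrArg Subtype.val this

end Comultiplication

/-- Convolution of functionals factoring through a compact quantum subgroup. -/
theorem IsCompactQuantumSubgroup.conv_coeff {𝔾 : LocallyCompactQuantumGroup A H}
    {ℍ : LocallyCompactQuantumGroup B K} {π : A →⋆ₙₐ[ℂ] B} (hπ : IsCompactQuantumSubgroup 𝔾 ℍ π)
    {θ : B →⋆ₙₐ[ℂ] (L →L[ℂ] L)} (hθ : θ 1 = 1) (x y z w : L) (a : A) :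
    𝔾.conv (coeff (θ.comp π) x y) (coeff (θ.comp π) z w) a =
      ⟪hTmul x z, ℍ.comulIn θ (π a) (hTmul y w)⟫_ℂ := by
  refine Tendsto.limUnder_eq ?_
  simp only [tensorFunctional_coeff 𝔾.rep_injective]
  set Θ := tensorHom 𝔾.rep (θ.comp π) (θ.comp π) with hΘ
  -- `Θ` factors through the tensor square of `ℍ.rep`, where `intertwines` supplies the product
  -- formula.
  have h1 : ∀ e, Θ (multiplierMul (𝔾.Δ a) e) = ℍ.comulIn θ (π a) * Θ e := fun e => by
    have hm := tensorHom_mem_spatialTensor 𝔾.rep_injective ℍ.rep π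
    rw [hΘ, ← tensorHom_comp 𝔾.rep_injective ℍ.rep_injective θ π e ⟨_, hm e⟩ rfl,
      ← tensorHom_comp 𝔾.rep_injective ℍ.rep_injective θ π _ ⟨_, hm _⟩ rfl]
    exact tensorHom_mul ℍ.rep_injective θ θ (hπ.intertwines a e).symm
  -- `A` need not be unital, but a lift `a₁` of `1` gives an element of `A ⊗ A` with image `1`.
  -- Strict convergence of `e` tested against it becomes norm convergence `Θ e → 1`.
  obtain ⟨a₁, ha₁⟩ := hπ.surjective 1
  have h2 : Θ (algToSpatial 𝔾.rep (a₁ ⊗ₜ a₁)) = 1 := by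
    rw [hΘ, tensorHom_algToSpatial _ 𝔾.rep_injective, algTensorHom_tmul]
    simp [ha₁, hθ, opTensor_one]
  have h3 : Tendsto Θ (strictUnitFilter (spatialTensor 𝔾.rep)) (𝓝 1) := by
    have := tendsto_mul_strictUnitFilter _ (algToSpatial 𝔾.rep (a₁ ⊗ₜ a₁))
    have h4 : Tendsto (fun e : spatialTensor 𝔾.rep => (⟨e.1 * (algToSpatial 𝔾.rep (a₁ ⊗ₜ a₁)).1,
        spatialTensor_mul_mem e.2 (algToSpatial 𝔾.rep (a₁ ⊗ₜ a₁)).2⟩ : spatialTensor 𝔾.rep))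
        (strictUnitFilter (spatialTensor 𝔾.rep)) (𝓝 (algToSpatial 𝔾.rep (a₁ ⊗ₜ a₁))) :=
      tendsto_subtype_rng.2 this
    have h5 := (Θ.continuous.tendsto _).comp h4
    rw [h2] at h5
    refine h5.congr fun e => ?_
    rw [Function.comp_apply, hΘ, tensorHom_mul 𝔾.rep_injective _ _ rfl, ← hΘ, h2, mul_one]
  simp only [h1]
  have h6 := h3.const_mul (ℍ.comulIn θ (π a))
  rw [mul_one] at h6
  exact tendsto_const_nhds.inner
    (((ContinuousLinearMap.apply ℂ _ (hTmul y w)).continuous.tendsto _).comp h6)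

end Compact

/-! ### Group-like elements in the GNS representation of the Haar state. -/

section HaarRepresentation

variable {B : Type*} [CStarAlgebra B]
  {L : Type*} [NormedAddCommGroup L] [InnerProductSpace ℂ L] [CompleteSpace L]

/-- A representation `θ` with a cyclic and separating unit vector `ξ`, together with a
`*`-homomorphism `δ` from `B` to the spatial tensor square of `θ(B)` for which the vector state of
`ξ` is invariant. -/
structure IsHaarRepresentation (θ : B →⋆ₙₐ[ℂ] (L →L[ℂ] L)) (ξ : L)
    (δ : B →⋆ₙₐ[ℂ] (HilbertTensor L L →L[ℂ] HilbertTensor L L)) : Prop where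
  map_one : θ 1 = 1
  norm_vec : ‖ξ‖ = 1
  cyclic : DenseRange fun b => θ b ξ
  separating : ∀ b, θ b ξ = 0 → b = 0
  mem_spatialTensor : ∀ b, δ b ∈ spatialTensor θ
  inner_right : ∀ b x y, ⟪hTmul x ξ, δ b (hTmul y ξ)⟫_ℂ = ⟪ξ, θ b ξ⟫_ℂ * ⟪x, y⟫_ℂ
  inner_left : ∀ b x y, ⟪hTmul ξ x, δ b (hTmul ξ y)⟫_ℂ = ⟪ξ, θ b ξ⟫_ℂ * ⟪x, y⟫_ℂ

namespace IsHaarRepresentation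

variable {θ : B →⋆ₙₐ[ℂ] (L →L[ℂ] L)} {ξ : L}
  {δ : B →⋆ₙₐ[ℂ] (HilbertTensor L L →L[ℂ] HilbertTensor L L)}
  (hR : IsHaarRepresentation θ ξ δ)
include hR

theorem injective : Function.Injective θ :=
  (injective_iff_map_eq_zero _).2 fun b hb => hR.separating b (by simp [hb])

omit hR in
theorem inner_star_mul {M : Type*} [NormedAddCommGroup M] [InnerProductSpace ℂ M]
    [CompleteSpace M] (σ : B →⋆ₙₐ[ℂ] (M →L[ℂ] M)) (b : B) (x y : M) :
    ⟪x, σ (star b) y⟫_ℂ = ⟪σ b x, y⟫_ℂ := by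
  rw [map_star, ContinuousLinearMap.star_eq_adjoint, ContinuousLinearMap.adjoint_inner_right]

/-- Invariance applied to `star b * b`. With `y = ξ` this is the isometry `V`; general `y` is what
makes slices converge in operator norm. -/
theorem norm_apply_hTmul (b : B) (y : L) : ‖δ b (hTmul y ξ)‖ = ‖θ b ξ‖ * ‖y‖ := by
  have h := hR.inner_right (star b * b) y y
  rw [map_mul, map_mul, mul_apply_eq_comp, mul_apply_eq_comp,
    inner_star_mul, inner_star_mul] at h
  simp only [inner_self_eq_norm_sq_to_K, ← mul_pow] at h
  have h' : ‖δ b (hTmul y ξ)‖ ^ 2 = (‖θ b ξ‖ * ‖y‖) ^ 2 := by exact_mod_cast h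
  exact (sq_eq_sq₀ (norm_nonneg _) (by positivity)).1 h'

/-- The implemented comultiplication is multiplicative on a vector representing a contractive
idempotent functional. -/
theorem tendsto_apply_hTmul {η : L} (hη : ‖η‖ ≤ 1) (hη0 : η ≠ 0)
    (hid : ∀ b, ⟪hTmul ξ ξ, δ b (hTmul η η)⟫_ℂ = ⟪ξ, θ b η⟫_ℂ) {b : ℕ → B}
    (hb : Tendsto (fun n => θ (b n) ξ) atTop (𝓝 η)) :
    ‖η‖ = 1 ∧ Tendsto (fun n => δ (b n) (hTmul ξ ξ)) atTop (𝓝 (hTmul η η)) := by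
  have hn0 : 0 < ‖η‖ := norm_pos_iff.2 hη0
  -- The cross term is idempotency, `hid`, at `star (b n)`, moved to the left side of the inner
  -- product.
  have h1 : ∀ n, ‖δ (b n) (hTmul ξ ξ) - hTmul η η‖ ^ 2 =
      ‖θ (b n) ξ‖ ^ 2 - 2 * RCLike.re ⟪θ (b n) ξ, η⟫_ℂ + (‖η‖ * ‖η‖) ^ 2 := fun n => by
    rw [@norm_sub_sq ℂ, hR.norm_apply_hTmul, hR.norm_vec, mul_one, norm_hTmul, ← inner_star_mul,
      hid, inner_star_mul]
  have h2 : Tendsto (fun n => ‖δ (b n) (hTmul ξ ξ) - hTmul η η‖ ^ 2) atTop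
      (𝓝 (‖η‖ ^ 2 - 2 * ‖η‖ ^ 2 + (‖η‖ * ‖η‖) ^ 2)) := by
    simp only [h1]
    refine ((hb.norm.pow 2).sub (Tendsto.const_mul 2 ?_)).add_const _
    rw [← @inner_self_eq_norm_sq ℂ]
    exact (RCLike.continuous_re.tendsto _).comp (hb.inner tendsto_const_nhds)
  -- The limit equals `‖η‖² (‖η‖² - 1)`, so its nonnegativity contradicts `0 < ‖η‖ < 1`; when `‖η‖ =
  -- 1` it is zero.
  have h3 : 0 ≤ ‖η‖ ^ 2 - 2 * ‖η‖ ^ 2 + (‖η‖ * ‖η‖) ^ 2 :=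
    ge_of_tendsto' h2 fun n => sq_nonneg _
  have h4 : ‖η‖ = 1 := by
    refine le_antisymm hη ?_
    by_contra! hlt
    have : ‖η‖ ^ 2 < 1 := by nlinarith
    nlinarith [mul_pos (pow_pos hn0 2) (sub_pos.2 this)]
  refine ⟨h4, ?_⟩
  rw [h4] at h2
  rw [tendsto_iff_norm_sub_tendsto_zero]
  have := h2.sqrt
  norm_num at this
  exact this

/-- A vector representing a contractive idempotent functional comes from an element which is
group-like. -/
theorem exists_groupLike {η : L} (hη : ‖η‖ ≤ 1) (hη0 : η ≠ 0)
    (hid : ∀ b, ⟪hTmul ξ ξ, δ b (hTmul η η)⟫_ℂ = ⟪ξ, θ b η⟫_ℂ) :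
    ∃ u, θ u ξ = η ∧ δ u = opTensor (θ u) (θ u) := by
  obtain ⟨x, hx, hlim⟩ := mem_closure_iff_seq_limit.1 (hR.cyclic η)
  choose b hbx using hx
  obtain rfl : (fun n => θ (b n) ξ) = x := funext hbx
  obtain ⟨h1, hw⟩ := hR.tendsto_apply_hTmul hη hη0 hid hlim
  -- Slicing with `η` on the left is chosen because `δ (b n) (ξ ⊗ ξ) → η ⊗ η`: the slices send `ξ`
  -- to vectors tending to `‖η‖² η = η`.
  choose s hs using fun n => exists_rightSlice hR.injective (hR.mem_spatialTensor (b n)) η ξ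
  have hdist : ∀ m n, dist (s m) (s n) ≤ dist (θ (b m) ξ) (θ (b n) ξ) := fun m n => by
    rw [← (NonUnitalStarAlgHom.isometry θ hR.injective).dist_eq, dist_eq_norm, hs, hs,
      ← ContinuousLinearMap.comp_sub, ← ContinuousLinearMap.sub_comp, ← map_sub]
    refine ContinuousLinearMap.opNorm_le_bound _ dist_nonneg fun y => ?_
    calc _ ≤ ‖(tmulRight η : L →L[ℂ] HilbertTensor L L).adjoint‖ * ‖δ (b m - b n) (hTmul y ξ)‖ :=
          ContinuousLinearMap.le_opNorm _ _
      _ ≤ 1 * ‖δ (b m - b n) (hTmul y ξ)‖ := by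
          gcongr
          rw [LinearIsometryEquiv.norm_map]
          exact (norm_tmulRight_le η).trans hη
      _ = _ := by rw [one_mul, hR.norm_apply_hTmul, dist_eq_norm, map_sub]; rfl
  have hc : CauchySeq s := by
    refine Metric.cauchySeq_iff.2 fun ε hε => ?_
    obtain ⟨N, hN⟩ := Metric.cauchySeq_iff.1 hlim.cauchySeq ε hε
    exact ⟨N, fun m hm n hn => (hdist m n).trans_lt (hN m hm n hn)⟩
  obtain ⟨u, hu⟩ := cauchySeq_tendsto_of_complete hc
  have hθu : θ u ξ = η := by
    have h2 : Tendsto (fun n => θ (s n) ξ) atTop (𝓝 (θ u ξ)) :=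
      ((ContinuousLinearMap.apply ℂ L ξ).continuous.tendsto _).comp
        (((NonUnitalStarAlgHom.isometry θ hR.injective).continuous.tendsto u).comp hu)
    refine tendsto_nhds_unique h2 ?_
    have h3 := ((tmulRight η : L →L[ℂ] HilbertTensor L L).adjoint.continuous.tendsto _).comp hw
    convert h3 using 2 with n
    · rw [hs]; rfl
    · refine ext_inner_left ℂ fun x => ?_
      rw [ContinuousLinearMap.adjoint_inner_right, tmulRight_apply, inner_hTmul,
        inner_self_eq_norm_sq_to_K, h1]
      simp
  refine ⟨u, hθu, sub_eq_zero.1 (eq_zero_of_apply_hTmul hR.injective hR.separating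
    (Submodule.sub_mem _ (hR.mem_spatialTensor u)
      (algTensorHom_mem_spatialTensor θ (u ⊗ₜ u))) ?_)⟩
  -- Both `δ u (ξ ⊗ ξ)` and `η ⊗ η` are limits of `δ (b n) (ξ ⊗ ξ)`: the first by the isometry and
  -- `θ (b n) ξ → θ u ξ`, the second by `hw`.
  rw [sub_apply, opTensor_hTmul, hθu, sub_eq_zero]
  refine tendsto_nhds_unique ?_ hw
  rw [tendsto_iff_norm_sub_tendsto_zero]
  have h4 : ∀ n, ‖δ (b n) (hTmul ξ ξ) - δ u (hTmul ξ ξ)‖ = ‖θ (b n) ξ - η‖ := fun n => by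
    rw [← sub_apply, ← map_sub, hR.norm_apply_hTmul, hR.norm_vec, mul_one, map_sub,
      sub_apply, hθu]
  simp only [h4]
  exact tendsto_iff_norm_sub_tendsto_zero.1 hlim

/-- A nonzero group-like element is unitary. -/
theorem mem_unitary {u : B} (hu0 : u ≠ 0) (hu : δ u = opTensor (θ u) (θ u)) : u ∈ unitary B := by
  -- For group-like `p = star w * w`, invariance reads `h(p) p = h(p) 1`, and `h(p) = ‖θ w ξ‖² ≠ 0`
  -- because `ξ` is separating.
  have key : ∀ w : B, δ (star w * w) = opTensor (θ (star w * w)) (θ (star w * w)) → w ≠ 0 →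
      star w * w = 1 := fun w hw hw0 => by
    refine hR.injective ?_
    rw [hR.map_one]
    ext y
    refine ext_inner_left ℂ fun x => ?_
    have h := hR.inner_right (star w * w) x y
    rw [hw, opTensor_hTmul, inner_hTmul, mul_comm] at h
    refine mul_left_cancel₀ ?_ h
    rw [map_mul, mul_apply_eq_comp, inner_star_mul, inner_self_ne_zero]
    exact fun h => hw0 (hR.separating w h)
  rw [Unitary.mem_iff]
  refine ⟨key u ?_ hu0, ?_⟩
  · rw [map_mul, map_star, hu, opTensor_star, ← opTensor_mul, map_mul, map_star]
  · have := key (star u) ?_ (star_ne_zero.2 hu0)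
    · rwa [star_star] at this
    · rw [star_star, map_mul, map_star, hu, opTensor_star, ← opTensor_mul, map_mul, map_star]

/-- The Haar state is invariant under conjugation by a group-like unitary. -/
theorem inner_groupLike {u : B} (hu : δ u = opTensor (θ u) (θ u)) (hu1 : u ∈ unitary B) (b : B) :
    ⟪θ u ξ, θ b (θ u ξ)⟫_ℂ = ⟪ξ, θ b ξ⟫_ℂ := by
  have hmul : ∀ x, θ u (θ (star u) x) = x := fun x => by
    rw [← mul_apply_eq_comp, ← map_mul, (Unitary.mem_iff.1 hu1).2, hR.map_one,
      one_apply_eq_self]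
  have hmul' : ∀ x, θ (star u) (θ u x) = x := fun x => by
    rw [← mul_apply_eq_comp, ← map_mul, (Unitary.mem_iff.1 hu1).1, hR.map_one,
      one_apply_eq_self]
  have hξ : ⟪ξ, ξ⟫_ℂ = 1 := by simp [inner_self_eq_norm_sq_to_K, hR.norm_vec]
  -- With `θ (star u) ξ` in the second leg, `δ u` sends `ξ ⊗ θ (star u) ξ` to `θ u ξ ⊗ ξ`. The same
  -- matrix coefficient can then be evaluated by invariance on the other leg.
  have h1 := hR.inner_left (star u * b * u) (θ (star u) ξ) (θ (star u) ξ)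
  simp only [map_mul, mul_apply_eq_comp, inner_star_mul] at h1
  rw [hu, opTensor_hTmul, hmul, hξ] at h1
  rw [hR.inner_right b (θ u ξ) (θ u ξ), ← inner_star_mul, hmul', hξ, mul_one] at h1
  simpa [inner_star_mul, hmul, hξ] using h1.symm

end IsHaarRepresentation

end HaarRepresentation

/-! ### Extending representations to the bidual, and the polar decomposition. -/

section BidualRep

variable {A : Type*} [NonUnitalCStarAlgebra A]
  {L : Type*} [NormedAddCommGroup L] [InnerProductSpace ℂ L] [CompleteSpace L]
  (θ : A →⋆ₙₐ[ℂ] (L →L[ℂ] L))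

theorem coeff_apply (x y : L) (a : A) : coeff θ x y a = ⟪x, θ a y⟫_ℂ := rfl

theorem norm_coeff_le (x y : L) : ‖coeff θ x y‖ ≤ ‖x‖ * ‖y‖ :=
  LinearMap.mkContinuous_norm_le _ (by positivity) _

/-- The extension of a representation of `A` to the bidual. -/
def bidualRep (x : Bidual A) : L →L[ℂ] L :=
  -- The operator representing the form acts in the first, conjugate-linear variable; the adjoint
  -- moves it to the second.
  (InnerProductSpace.continuousLinearMapOfBilin (𝕜 := ℂ)
    (LinearMap.mkContinuous₂
      (LinearMap.mk₂'ₛₗ (starRingEnd ℂ) (RingHom.id ℂ) (fun y z : L => x (coeff θ y z))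
        (fun y y' z => by
          rw [← map_add]; congr 1; ext a; simp [coeff_apply])
        (fun c y z => by
          rw [← map_smul]; congr 1; ext a; simp [coeff_apply, mul_comm])
        (fun y z z' => by
          rw [← map_add]; congr 1; ext a; simp [coeff_apply])
        (fun c y z => by
          rw [← map_smul]; congr 1; ext a; simp [coeff_apply]))
      ‖x‖ (fun y z => (x.le_opNorm _).trans (by
        rw [mul_assoc]; gcongr; exact norm_coeff_le θ y z)))).adjoint

theorem inner_bidualRep (x : Bidual A) (y z : L) : ⟪y, bidualRep θ x z⟫_ℂ = x (coeff θ y z) := by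
  rw [bidualRep, ContinuousLinearMap.adjoint_inner_right,
    InnerProductSpace.continuousLinearMapOfBilin_apply]
  rfl

/-- Acting on a vector functional moves its right-hand vector. This produces `η` from `ω = v.|ω|_r`
and also yields multiplicativity of `bidualRep`. -/
theorem bidualAct_coeff (x : Bidual A) (y z : L) :
    bidualAct x (coeff θ y z) = coeff θ y (bidualRep θ x z) := by
  ext a
  rw [bidualAct_apply, coeff_apply, ← ContinuousLinearMap.adjoint_inner_left, inner_bidualRep]
  congr 1
  ext b
  simp [functionalMul, coeff_apply, ContinuousLinearMap.adjoint_inner_left]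

theorem bidualRep_mul (x y : Bidual A) :
    bidualRep θ (bidualMul x y) = bidualRep θ x * bidualRep θ y := by
  ext w
  refine ext_inner_left ℂ fun z => ?_
  rw [inner_bidualRep, mul_apply_eq_comp, inner_bidualRep]
  exact congrArg x (bidualAct_coeff θ y z w)

theorem bidualRep_star (x : Bidual A) : bidualRep θ (bidualStar x) = star (bidualRep θ x) := by
  ext w
  refine ext_inner_left ℂ fun z => ?_
  rw [inner_bidualRep, ContinuousLinearMap.star_eq_adjoint, ContinuousLinearMap.adjoint_inner_right,
    ← inner_conj_symm, inner_bidualRep]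
  refine congrArg (fun f => star (x f)) ?_
  ext a
  simp only [functionalConj, coeff_apply, LinearMap.mkContinuous_apply, LinearMap.coe_mk,
    AddHom.coe_mk, Complex.star_def, inner_conj_symm]
  rw [map_star, ContinuousLinearMap.star_eq_adjoint, ContinuousLinearMap.adjoint_inner_left]

/-- With `W` the image of `v`, `W* W` is a projection, so the C⋆-identity gives `n = n²` for `n =
‖W‖²`. -/
theorem norm_bidualRep_le_one {v : Bidual A} (hv : bidualMul v (bidualMul (bidualStar v) v) = v) :
    ‖bidualRep θ v‖ ≤ 1 := by
  have h := congrArg (bidualRep θ) hv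
  rw [bidualRep_mul, bidualRep_mul, bidualRep_star] at h
  set W := bidualRep θ v
  have h1 : ‖W‖ * ‖W‖ = (‖W‖ * ‖W‖) * (‖W‖ * ‖W‖) := by
    rw [← CStarRing.norm_star_mul_self (x := W), ← CStarRing.norm_star_mul_self (x := star W * W)]
    congr 1
    rw [star_mul, star_star, mul_assoc, h]
  by_contra! hlt
  have h2 : 1 < ‖W‖ * ‖W‖ := one_lt_mul_of_lt_of_le hlt hlt.le
  generalize ‖W‖ * ‖W‖ = n at h1 h2
  nlinarith

/-- Counterpart of `bidualAct_coeff` for the left-hand vector, used to compute the left absolute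
value. -/
theorem actBidual_coeff (x : Bidual A) (y z : L) :
    actBidual (coeff θ y z) (bidualStar x) = coeff θ (bidualRep θ x y) z := by
  ext a
  have : mulFunctional a (coeff θ y z) = coeff θ y (θ a z) := by
    ext b; simp [mulFunctional, coeff_apply]
  rw [actBidual_apply, coeff_apply, this, ← inner_bidualRep, bidualRep_star,
    ContinuousLinearMap.star_eq_adjoint, ContinuousLinearMap.adjoint_inner_right]

/-- The chosen polar decomposition is one, unless the right absolute value vanishes. -/
theorem isPolarDecomposition_polar {ω : StrongDual ℂ A} (h : rightAbs ω ≠ 0) :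
    IsPolarDecomposition ω (polar ω).1 (rightAbs ω) := by
  unfold rightAbs polar at *
  split_ifs with hex
  · exact hex.choose_spec
  -- `polar` takes the value `0` when no decomposition exists, which `h` excludes.
  · rw [dif_neg hex] at h; exact absurd rfl h

end BidualRep

/-! ### Faithfulness of the Haar state and its GNS representation. -/

section HaarState

variable {B : Type*} [CStarAlgebra B] [PartialOrder B] [StarOrderedRing B]
  {K : Type*} [NormedAddCommGroup K] [InnerProductSpace ℂ K] [CompleteSpace K]

namespace IsFaithfulKMSWeight

variable {φ : B → ℝ≥0∞} (hφ : IsFaithfulKMSWeight φ)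
include hφ

theorem mono {a b : B} (ha : 0 ≤ a) (hab : a ≤ b) : φ a ≤ φ b := by
  have := hφ.map_add a (b - a) ha (sub_nonneg.2 hab)
  rw [add_sub_cancel] at this
  rw [this]; exact le_self_add

theorem map_zero : φ 0 = 0 := by simpa using hφ.map_smul 0 0 le_rfl le_rfl

/-- A densely defined weight on a unital algebra is finite. -/
theorem lt_top {a : B} (ha : 0 ≤ a) : φ a < ∞ := by
  -- An element `c` of finite weight within `1/2` of `1` satisfies `c ≥ 1/2`, whence `a ≤ ‖a‖ 1 ≤ 2
  -- ‖a‖ c`.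
  obtain ⟨c, ⟨hc, hcφ⟩, hd⟩ := Metric.mem_closure_iff.1
    (hφ.denselyDefined (show (0 : B) ≤ 1 from zero_le_one)) (1 / 2) (by norm_num)
  have h1 : (1 : B) - c ≤ algebraMap ℝ B (1 / 2) := by
    have hsa : IsSelfAdjoint ((1 : B) - c) :=
      (IsSelfAdjoint.one B).sub (IsSelfAdjoint.of_nonneg hc)
    refine hsa.le_algebraMap_norm_self.trans (algebraMap_mono B ?_)
    rw [← dist_eq_norm]; exact hd.le
  have h2 : algebraMap ℝ B (1 / 2) ≤ c := by
    have h3 : algebraMap ℝ B (1 / 2) + algebraMap ℝ B (1 / 2) = 1 := by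
      rw [Algebra.algebraMap_eq_smul_one, ← add_smul]; norm_num
    rw [← h3] at h1
    have := sub_le_iff_le_add.1 h1
    exact le_of_add_le_add_left this
  have h4 : a ≤ ((2 * ‖a‖ : ℝ) : ℂ) • c := by
    calc a ≤ algebraMap ℝ B ‖a‖ := (IsSelfAdjoint.of_nonneg ha).le_algebraMap_norm_self
      _ = (2 * ‖a‖ : ℝ) • algebraMap ℝ B (1 / 2) := by
        rw [Algebra.algebraMap_eq_smul_one, Algebra.algebraMap_eq_smul_one, smul_smul]
        congr 1; ring
      _ ≤ (2 * ‖a‖ : ℝ) • c := smul_le_smul_of_nonneg_left h2 (by positivity)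
      _ = _ := (Complex.coe_smul _ _).symm
  refine (hφ.mono ha h4).trans_lt ?_
  rw [hφ.map_smul _ _ (by positivity) hc]
  exact ENNReal.mul_lt_top ENNReal.ofReal_lt_top hcφ

end IsFaithfulKMSWeight

/-- The Haar state of a (reduced) compact quantum group is faithful. -/
theorem IsHaarState.faithful {ℍ : LocallyCompactQuantumGroup B K} {h : StrongDual ℂ B}
    (hh : IsHaarState ℍ h) {b : B} (hb : h (star b * b) = 0) : b = 0 := by
  obtain ⟨φ, hφ, hinv⟩ := ℍ.exists_leftHaarWeight
  -- The slice of `star b * b` by `h` is `h (star b * b) • 1 = 0`, so left invariance gives `0 = ‖h‖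
  -- φ (star b * b)`.
  have h1 := hinv h (star b * b) _ hh.positive (star_mul_self_nonneg b)
    (hφ.lt_top (star_mul_self_nonneg b)) (hh.right_invariant _)
  rw [hb, zero_smul, hφ.map_zero, eq_comm, mul_eq_zero] at h1
  have h2 : ENNReal.ofReal ‖h‖ ≠ 0 := by
    rw [Ne, ENNReal.ofReal_eq_zero, not_le, norm_pos_iff]
    rintro rfl
    simpa using hh.map_one
  exact CStarRing.star_mul_self_eq_zero_iff b |>.1
    (hφ.faithful _ (star_mul_self_nonneg b) (h1.resolve_left h2))

/-- A state is a vector state of a cyclic representation. -/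
theorem exists_cyclic_representation.{u} {B : Type u} [CStarAlgebra B] [PartialOrder B]
    [StarOrderedRing B] {h : StrongDual ℂ B} (hh : IsPositiveFunctional h) :
    ∃ (L : Type u) (_ : NormedAddCommGroup L) (_ : InnerProductSpace ℂ L) (_ : CompleteSpace L)
      (θ : B →⋆ₙₐ[ℂ] (L →L[ℂ] L)) (ξ : L), θ 1 = 1 ∧ (DenseRange fun b => θ b ξ) ∧
        ∀ b, ⟪ξ, θ b ξ⟫_ℂ = h b := by
  let f : B →ₚ[ℂ] ℂ := PositiveLinearMap.mk₀ (h : B →ₗ[ℂ] ℂ) fun x hx => by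
    obtain ⟨y, rfl⟩ := CStarAlgebra.nonneg_iff_eq_star_mul_self.1 hx
    exact hh y
  -- The cyclic vector is the class of `1`, whose orbit is the dense image of `B`.
  have hθ : ∀ b, f.gnsNonUnitalStarAlgHom b ((f.toPreGNS 1 : f.PreGNS) : f.GNS) =
      ((f.toPreGNS b : f.PreGNS) : f.GNS) := fun b => by
    rw [PositiveLinearMap.gnsNonUnitalStarAlgHom_apply_coe]; simp
  refine ⟨f.GNS, inferInstance, inferInstance, inferInstance, f.gnsNonUnitalStarAlgHom,
    ((f.toPreGNS 1 : f.PreGNS) : f.GNS), map_one f.gnsStarAlgHom, ?_, fun b => ?_⟩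
  · simp only [hθ]
    exact UniformSpace.Completion.denseRange_coe.comp f.toPreGNS.surjective.denseRange
      (UniformSpace.Completion.continuous_coe _)
  · rw [hθ, UniformSpace.Completion.inner_coe, PositiveLinearMap.preGNS_inner_def]
    simp only [f, PositiveLinearMap.ofPreGNS_toPreGNS, star_one, one_mul]
    rfl

/-- The invariance fields are those of `h` tested on the functionals `coeff θ x y`; `ξ` is
separating because `h` is faithful. -/
theorem IsHaarState.isHaarRepresentation {ℍ : LocallyCompactQuantumGroup B K}
    {h : StrongDual ℂ B} (hh : IsHaarState ℍ h)
    {L : Type*} [NormedAddCommGroup L] [InnerProductSpace ℂ L] [CompleteSpace L]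
    {θ : B →⋆ₙₐ[ℂ] (L →L[ℂ] L)} {ξ : L} (h1 : θ 1 = 1) (hd : DenseRange fun b => θ b ξ)
    (hξ : ∀ b, ⟪ξ, θ b ξ⟫_ℂ = h b) : IsHaarRepresentation θ ξ (ℍ.comulIn θ) := by
  have hc : h = coeff θ ξ ξ := by ext b; rw [coeff_apply, hξ]
  refine ⟨h1, ?_, hd, fun b hb => hh.faithful ?_, ℍ.comulIn_mem_spatialTensor θ,
    fun b x y => ?_, fun b x y => ?_⟩
  · have := hξ 1
    rw [h1, hh.map_one, one_apply_eq_self] at this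
    have h2 : ‖ξ‖ ^ 2 = 1 := by rw [← inner_self_eq_norm_sq (𝕜 := ℂ), this]; simp
    exact (pow_eq_one_iff_of_nonneg (norm_nonneg ξ) two_ne_zero).1 h2
  · rw [← hξ, map_mul, mul_apply_eq_comp, hb]; simp
  · have := hh.left_invariant b (coeff θ x y)
    rw [hc, ℍ.conv_coeff, ← hc, coeff_apply, map_smul, h1] at this
    rw [← this, hξ]; simp
  · have := hh.right_invariant b (coeff θ x y)
    rw [hc, ℍ.conv_coeff, ← hc, coeff_apply, map_smul, h1] at this
    rw [← this, hξ]; simp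

end HaarState

end

end QuantumGroup

theorem mainTheorem2 {A : Type*} [NonUnitalCStarAlgebra A] [PartialOrder A] [StarOrderedRing A]
    {H : Type*} [NormedAddCommGroup H] [InnerProductSpace ℂ H] [CompleteSpace H]
    (𝔾 : QuantumGroup.LocallyCompactQuantumGroup A H) (h𝔾 : 𝔾.IsCoamenable)
    {B : Type*} [CStarAlgebra B] [PartialOrder B] [StarOrderedRing B]
    {K : Type*} [NormedAddCommGroup K] [InnerProductSpace ℂ K] [CompleteSpace K]
    (ℍ : QuantumGroup.LocallyCompactQuantumGroup B K) (π : A →⋆ₙₐ[ℂ] B)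
    (hπ : QuantumGroup.IsCompactQuantumSubgroup 𝔾 ℍ π)
    (h : StrongDual ℂ B) (hh : QuantumGroup.IsHaarState ℍ h)
    (ω : StrongDual ℂ A) (hω : 𝔾.IsContractiveIdempotent ω)
    (hHaar : ∀ a, QuantumGroup.rightAbs ω a = h (π a)) :
    (∃ u : B, QuantumGroup.IsGroupLikeUnitary ℍ u ∧ ∀ a, ω a = h (π a * u)) ∧
      QuantumGroup.rightAbs ω = QuantumGroup.leftAbs ω := by
  obtain ⟨L, _, _, _, θ, ξ, hθ1, hd, hξ⟩ :=
    QuantumGroup.exists_cyclic_representation hh.positive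
  have hR := hh.isHaarRepresentation hθ1 hd hξ
  obtain ⟨a₁, ha₁⟩ := hπ.surjective 1
  -- At a lift of `1` the right absolute value equals `h 1 = 1`, so `polar ω` is a genuine polar
  -- decomposition.
  have hne : QuantumGroup.rightAbs ω ≠ 0 := fun h0 => by
    have := hHaar a₁
    rw [h0, ha₁, hh.map_one] at this
    simp at this
  have hp := QuantumGroup.isPolarDecomposition_polar hne
  have hφ : QuantumGroup.rightAbs ω = QuantumGroup.coeff (θ.comp π) ξ ξ := by
    ext a
    rw [hHaar, ← hξ]; rfl
  set v := (QuantumGroup.polar ω).1 with hv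
  set η := QuantumGroup.bidualRep (θ.comp π) v ξ with hη
  have hω' : ω = QuantumGroup.coeff (θ.comp π) ξ η := by
    rw [hη, ← QuantumGroup.bidualAct_coeff, ← hφ]; exact hp.eq_act
  have hη1 : ‖η‖ ≤ 1 := by
    refine (ContinuousLinearMap.le_opNorm _ _).trans ?_
    rw [hR.norm_vec, mul_one]
    exact QuantumGroup.norm_bidualRep_le_one _ hp.partialIsometry
  have hη0 : η ≠ 0 := fun h0 => hω.ne_zero (by
    rw [hω', h0]; ext a; simp [QuantumGroup.coeff_apply])
  -- Idempotency of `ω` on `A` descends to `B`, since `ω` is a coefficient of `θ ∘ π` and `π` is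
  -- surjective.
  have hid : ∀ b, ⟪QuantumGroup.hTmul ξ ξ, ℍ.comulIn θ b (QuantumGroup.hTmul η η)⟫_ℂ =
      ⟪ξ, θ b η⟫_ℂ := fun b => by
    obtain ⟨a, rfl⟩ := hπ.surjective b
    have := hω.idempotent a
    rw [hω', hπ.conv_coeff hθ1] at this
    exact this
  obtain ⟨u, hu, hΔ⟩ := hR.exists_groupLike hη1 hη0 hid
  have hu0 : u ≠ 0 := by
    rintro rfl
    exact hη0 (by rw [← hu]; simp)
  have hU := hR.mem_unitary hu0 hΔ
  refine ⟨⟨u, ⟨hU, ℍ.comul_eq_of_comulIn_eq hR.injective hΔ⟩, fun a => ?_⟩, ?_⟩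
  · rw [← hξ, map_mul, mul_apply_eq_comp, hu, hω']; rfl
  · have hl : QuantumGroup.leftAbs ω = QuantumGroup.coeff (θ.comp π) η η := by
      rw [QuantumGroup.leftAbs, ← hp.eq_act, ← hv, hω', QuantumGroup.actBidual_coeff]
    rw [hl, hφ]
    ext a
    have := hR.inner_groupLike hΔ hU (π a)
    rw [hu] at this
    exact this.symm
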